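/- Let $\Bbbk$ be an algebraically closed field, let $G$ be an affine algebraic group over $\Bbbk$ with Hopf algebra of polynomial functions $\Bbbk[G]$ (a finitely generated, reduced, commutative Hopf algebra), and let $H\subseteq G$ be a closed subgroup, with restriction map $\pi:\Bbbk[G]\to\Bbbk[H]$. A rational $H$-module is a right $\Bbbk[H]$-comodule $\chi:M\to M\otimes\Bbbk[H]$, $\chi(m)=\sum m_0\otimes m_1$, on which $x\in H$ acts by $x\cdot m=\sum m_0\,m_1(x)$; write ${}^HM=\{m\in M: x\cdot m=m \text{ for all } x\in H\}$. In particular $H$ acts on $\Bbbk[H]$ and on $\Bbbk[G]$ by $(x\cdot f)(y)=f(yx)$. A $(\Bbbk[G],H)$-module is a $\Bbbk[G]$-module $M$ that is also a rational $H$-module (with the same underlying $\Bbbk$-vector space) such that $x\cdot(rm)=(x\cdot r)(x\cdot m)$ for all $x\in H$, $r\in\Bbbk[G]$, $m\in M$; morphisms are the $\Bbbk[G]$-linear $H$-equivariant maps. The homogeneous space $G/H$ is the set of cosets $xH$ with the quotient topology of the Zariski topology of $G$, a function on an open set $U\subseteq G/H$ being regular if its composition with the projection $p:G\to G/H$ is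 regular on $p^{-1}(U)$. The following three conditions are equivalent: \begin{enumerate} \item $H$ is exact in $G$: for every short exact sequence $0\to P\to Q\to R\to 0$ of $(\Bbbk[G],H)$-modules, the sequence $0\to{}^HP\to{}^HQ\to{}^HR\to 0$ is exact. \item The homogeneous space $G/H$ is affine, i.e. isomorphic, as a space with functions, to an affine variety (the variety of a finitely generated reduced commutative $\Bbbk$-algebra). \item There is a total integral $\sigma:\Bbbk[H]\to\Bbbk[G]$, i.e. a $\Bbbk$-linear map with $\sigma(x\cdot f)=x\cdot\sigma(f)$ for all $x\in H$, $f\in\Bbbk[H]$, and $\sigma(1)=1$. \end{enumerate} -/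

import Mathlib

/-!
Affine algebraic groups over an algebraically closed field `k` are given by their Hopf algebras of
polynomial functions: finitely generated, reduced, commutative Hopf algebras `A = k[G]`, the
abstract group `G` being the group of `k`-algebra homomorphisms `A → k` under convolution.
A closed inclusion `H ⊆ G` is given by its restriction map, a surjective homomorphism
`π : k[G] → k[H]` of Hopf algebras.
-/

open scoped TensorProduct

universe u

namespace Observability

noncomputable section

/-- The set of points of the affine variety with coordinate algebra `C`.  If `C = k[G]` is a Hopf
algebra, this is the group `G`, with product characterised by `f (x y) = ∑ f₁ (x) f₂ (y)`; the
group structure is Mathlib's convolution group. -/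
abbrev Points (k C : Type u) [Field k] [CommRing C] [Algebra k C] : Type u :=
  WithConv (C →ₐ[k] k)

section Varieties

variable {k C : Type u} [Field k] [CommRing C] [Algebra k C]

/-- The maximal ideal of functions vanishing at `x`, as a point of the prime spectrum. -/
def Points.toPrimeSpectrum (x : Points k C) : PrimeSpectrum C :=
  ⟨RingHom.ker x.ofConv, RingHom.ker_isPrime _⟩

/-- The Zariski topology on the set of points. -/
instance Points.zariskiTopology : TopologicalSpace (Points k C) :=
  TopologicalSpace.induced Points.toPrimeSpectrum inferInstance

/-- The function `f` is regular on the subset `U` (used for `U` open) of an affine variety: near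
every point of `U` it is a quotient of two polynomial functions.  Only the values of `f` on `U`
matter. -/
def IsRegularOn (U : Set (Points k C)) (f : Points k C → k) : Prop :=
  ∀ x ∈ U, ∃ a s : C, x s ≠ 0 ∧ ∀ y ∈ U, y s ≠ 0 → f y = y a / y s

/-- A space with functions, i.e. a topological space `X` with a notion `reg U f` of `k`-valued
function `f` regular on the open set `U`, is affine if it is isomorphic to the affine variety of
some finitely generated reduced commutative `k`-algebra: there is a homeomorphism which, over each
open set, identifies the regular functions. -/
def IsAffineSpace (k : Type u) [Field k] (X : Type u) [TopologicalSpace X]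
    (reg : Set X → (X → k) → Prop) : Prop :=
  ∃ (C : Type u) (_ : CommRing C) (_ : Algebra k C),
    Algebra.FiniteType k C ∧ IsReduced C ∧
      ∃ e : X ≃ₜ Points k C, ∀ U : Set (Points k C), IsOpen U →
        ∀ f : Points k C → k, IsRegularOn U f ↔ reg (e ⁻¹' U) (f ∘ e)

end Varieties

section Comodules

variable {k A B : Type u} [Field k] [CommRing A] [HopfAlgebra k A] [CommRing B] [HopfAlgebra k B]

/-- A structure of rational `H`-module on the vector space `M`: a right comodule structure
`χ : M → M ⊗ B` over `B = k[H]`. -/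
structure RationalAction (k B : Type u) [Field k] [CommRing B] [HopfAlgebra k B]
    (M : Type u) [AddCommGroup M] [Module k M] where
  coact : M →ₗ[k] M ⊗[k] B
  coassoc : (TensorProduct.assoc k M B B).toLinearMap ∘ₗ coact.rTensor B ∘ₗ coact =
    (Coalgebra.comul (R := k) (A := B)).lTensor M ∘ₗ coact
  counit_comp : (TensorProduct.rid k M).toLinearMap ∘ₗ
    (Coalgebra.counit (R := k) (A := B)).lTensor M ∘ₗ coact = LinearMap.id

namespace RationalAction

variable {M : Type u} [AddCommGroup M] [Module k M]

/-- The action of the group: `x · m = ∑ m₀ m₁(x)`, where `χ m = ∑ m₀ ⊗ m₁`. -/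
def act (ρ : RationalAction k B M) (x : Points k B) : M →ₗ[k] M :=
  (TensorProduct.rid k M).toLinearMap ∘ₗ x.ofConv.toLinearMap.lTensor M ∘ₗ ρ.coact

/-- The elements of `M` fixed by all the elements of the group. -/
def invariants (ρ : RationalAction k B M) : Submodule k M where
  carrier := {m | ∀ x : Points k B, ρ.act x m = m}
  add_mem' hm hn x := by rw [map_add, hm x, hn x]
  zero_mem' x := map_zero _
  smul_mem' c m hm x := by rw [map_smul, hm x]

/-- The algebra `k[G]` as a rational `G`-module, `x · f = ∑ f₁ f₂(x)`. -/
def regular (k B : Type u) [Field k] [CommRing B] [HopfAlgebra k B] : RationalAction k B B where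
  coact := Coalgebra.comul
  coassoc := Coalgebra.coassoc
  counit_comp := by
    ext b
    simp

/-- Restriction `N|_H` of a rational `G`-module to `H`: the coaction becomes
`∑ n₀ ⊗ π (n₁)`. -/
def restrict (π : A →ₐc[k] B) (ρ : RationalAction k A M) : RationalAction k B M where
  coact := (π : A →ₗ[k] B).lTensor M ∘ₗ ρ.coact
  coassoc := by
    have hπ : TensorProduct.map (π : A →ₗ[k] B) (π : A →ₗ[k] B) ∘ₗ Coalgebra.comul =
        Coalgebra.comul ∘ₗ (π : A →ₗ[k] B) := CoalgHomClass.map_comp_comul π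
    rw [← LinearMap.comp_assoc _ _ (Coalgebra.comul.lTensor M), ← LinearMap.lTensor_comp, ← hπ,
      LinearMap.lTensor_comp, LinearMap.comp_assoc, ← ρ.coassoc]
    simp only [← LinearMap.comp_assoc]
    congr 1
    rw [LinearMap.rTensor_comp]
    simp only [LinearMap.comp_assoc]
    have h₁ : ρ.coact.rTensor B ∘ₗ (π : A →ₗ[k] B).lTensor M =
        (π : A →ₗ[k] B).lTensor (M ⊗[k] A) ∘ₗ ρ.coact.rTensor A := by
      rw [LinearMap.rTensor_comp_lTensor, LinearMap.lTensor_comp_rTensor]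
    rw [h₁]
    simp only [← LinearMap.comp_assoc]
    congr 1
    ext m a b
    simp
  counit_comp := by
    have hπ : Coalgebra.counit ∘ₗ (π : A →ₗ[k] B) = Coalgebra.counit :=
      CoalgHomClass.counit_comp π
    rw [← LinearMap.comp_assoc _ _ (Coalgebra.counit.lTensor M), ← LinearMap.lTensor_comp, hπ,
      ρ.counit_comp]

end RationalAction

/-- The rational `H`-module structure of `k[G]`, the restriction of the one of the `G`-module
`k[G]`. -/
def coordinateAction (π : A →ₐc[k] B) : RationalAction k B A :=
  (RationalAction.regular k A).restrict π

/-- A `(k[G], H)`-module: a `k[G]`-module which is a rational `H`-module (over the same vector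
space structure) with `x · (r m) = (x · r) (x · m)` for `x ∈ H`, `r ∈ k[G]`. -/
structure EquivariantModule (π : A →ₐc[k] B) where
  carrier : Type u
  [addCommGroup : AddCommGroup carrier]
  [moduleBase : Module k carrier]
  [module : Module A carrier]
  [isScalarTower : IsScalarTower k A carrier]
  action : RationalAction k B carrier
  act_smul : ∀ (x : Points k B) (r : A) (m : carrier),
    action.act x (r • m) = (coordinateAction π).act x r • action.act x m

namespace EquivariantModule

attribute [instance] addCommGroup moduleBase module isScalarTower

variable {π : A →ₐc[k] B}

/-- The subspace of `H`-invariants of a `(k[G], H)`-module. -/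
abbrev invariants (M : EquivariantModule π) : Submodule k M.carrier :=
  M.action.invariants

/-- A morphism of `(k[G], H)`-modules: a `k[G]`-linear and `H`-equivariant map. -/
structure Hom (M N : EquivariantModule π) where
  toLinearMap : M.carrier →ₗ[A] N.carrier
  map_act : ∀ (x : Points k B) (m : M.carrier),
    toLinearMap (M.action.act x m) = N.action.act x (toLinearMap m)

/-- The map induced on the invariants by a morphism. -/
def Hom.onInvariants {M N : EquivariantModule π} (f : Hom M N) (m : M.invariants) :
    N.invariants :=
  ⟨f.toLinearMap m, fun x => by rw [← f.map_act, m.2 x]⟩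

end EquivariantModule

/-- The closed subgroup `H` is exact in `G`: for every short exact sequence `0 → P → Q → R → 0` of
`(k[G], H)`-modules the sequence of invariants is exact. -/
def IsExactSubgroup (π : A →ₐc[k] B) : Prop :=
  ∀ (P Q R : EquivariantModule π) (f : P.Hom Q) (g : Q.Hom R),
    Function.Injective f.toLinearMap → Function.Exact f.toLinearMap g.toLinearMap →
      Function.Surjective g.toLinearMap →
    Function.Injective f.onInvariants ∧ Function.Exact f.onInvariants g.onInvariants ∧
      Function.Surjective g.onInvariants

/-- A total integral for `H` with values in `k[G]`: an `H`-equivariant linear map `k[H] → k[G]`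
that maps `1` to `1`. -/
structure IsTotalIntegral (π : A →ₐc[k] B) (σ : B →ₗ[k] A) : Prop where
  map_act : ∀ (x : Points k B) (f : B),
    σ ((RationalAction.regular k B).act x f) = (coordinateAction π).act x (σ f)
  map_one : σ 1 = 1

/-- The inclusion `H → G` of groups of points. -/
def inclusion (π : A →ₐc[k] B) : Points k B →* Points k A where
  toFun x := WithConv.toConv (x.ofConv.comp (π : A →ₐ[k] B))
  map_one' := by
    ext a
    simp
  map_mul' x y := by
    apply WithConv.ofConv_injective
    exact AlgHom.convMul_comp_bialgHom_distrib x y π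

/-- `H` as a subgroup of `G`. -/
abbrev subgroup (π : A →ₐc[k] B) : Subgroup (Points k A) :=
  (inclusion π).range

/-- The homogeneous space `G/H`, the set of cosets `xH` with the quotient topology. -/
abbrev HomogeneousSpace (π : A →ₐc[k] B) : Type u :=
  Points k A ⧸ subgroup π

/-- The structure sheaf of `G/H`: a function on an open subset `U` of `G/H` is regular if its
composition with the projection `G → G/H` is regular on the inverse image of `U`. -/
def IsRegularOnQuotient (π : A →ₐc[k] B) (U : Set (HomogeneousSpace π))
    (f : HomogeneousSpace π → k) : Prop :=
  IsRegularOn ((fun x : Points k A => (x : HomogeneousSpace π)) ⁻¹' U)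
    (fun x : Points k A => f (x : HomogeneousSpace π))

/-- The homogeneous space `G/H` is an affine variety. -/
def IsAffineHomogeneousSpace (π : A →ₐc[k] B) : Prop :=
  IsAffineSpace k (HomogeneousSpace π) (IsRegularOnQuotient π)

end Comodules

end

end Observability

/-!
Averaging an element `m` of a `(k[G], H)`-module by `m ↦ ∑ σ(S m₁) m₀` uses the equivariance of `σ`
only on the finitely many `m₁` which occur, so invariants lift along surjections as soon as there
are local integrals, equivariant on a given finite subset of `k[H]`.

If `G/H` is affine, let `V ⊆ k[G]` be a finite-dimensional `H`-stable subspace containing `1`. An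
endomorphism `s` of the `H`-module `k[G]` with `s 1 = 1` which vanishes on the kernel `W` of
`V → k[H]` induces a local integral on the image of `V`. The values at `1` of the endomorphisms
vanishing on `W` form an ideal of `k[G]^H = k[G/H]` without zeros on `G/H`: on a neighbourhood of
any coset, Cramer's rule writes the restriction of a left translation to `W` as a combination of
others with invariant coefficients.

If `H` is exact, applying exactness to the modules of linear maps from finite-dimensional rational
`H`-modules to `k[G]` shows that equivariant maps to `k[G]` extend from stable subspaces; extending
`1 ↦ 1` from `k` to `k[H]` yields a total integral.

A total integral makes `k[G]^H` a direct summand of `k[G]` over itself. The retraction separates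
disjoint closed subsets of `G/H` by invariants and shows that an ideal of `k[G]^H` with no zeros on
`G` is the unit ideal. Some localization of `k[G]^H` at an element is finitely generated, as for any
subalgebra of a finitely generated algebra, and hence, translating this element by `G`, so is
`k[G]^H`. Its variety is `G/H`.
-/

namespace Observability

noncomputable section

/-! ### Functions on affine varieties -/

section Points

variable {k C : Type u} [Field k] [CommRing C] [Algebra k C]

namespace Points

theorem isOpen_ne_zero (s : C) : IsOpen {x : Points k C | x s ≠ 0} :=
  ⟨_, PrimeSpectrum.isOpen_basicOpen (a := s), rfl⟩

theorem exists_ne_zero_subset {U : Set (Points k C)} (hU : IsOpen U) {x : Points k C}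
    (hx : x ∈ U) : ∃ s : C, x s ≠ 0 ∧ ∀ y : Points k C, y s ≠ 0 → y ∈ U := by
  obtain ⟨V, hV, rfl⟩ := hU
  obtain ⟨_, ⟨s, rfl⟩, hxs, hsV⟩ :=
    PrimeSpectrum.isTopologicalBasis_basic_opens.exists_subset_of_mem_open hx hV
  exact ⟨s, hxs, fun y hy => hsV (show y.toPrimeSpectrum ∈ _ from hy)⟩

/-- The ideal `I(S)` of the functions vanishing on a set `S` of points. -/
def vanishingIdeal (S : Set (Points k C)) : Ideal C :=
  ⨅ x ∈ S, RingHom.ker x.ofConv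

theorem mem_vanishingIdeal {S : Set (Points k C)} {a : C} :
    a ∈ vanishingIdeal S ↔ ∀ x ∈ S, x a = 0 := by
  simp only [vanishingIdeal, Submodule.mem_iInf, RingHom.mem_ker]

theorem exists_mem_vanishingIdeal_of_notMem {S : Set (Points k C)} (hS : IsClosed S)
    {x : Points k C} (hx : x ∉ S) : ∃ a ∈ vanishingIdeal S, x a ≠ 0 := by
  obtain ⟨a, hxa, ha⟩ := exists_ne_zero_subset hS.isOpen_compl hx
  exact ⟨a, mem_vanishingIdeal.2 fun y hy => by_contra fun h => ha y h hy, hxa⟩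

section Nullstellensatz

variable [IsAlgClosed k] [Algebra.FiniteType k C]

theorem exists_ker_eq (m : Ideal C) [m.IsMaximal] :
    ∃ x : Points k C, ∀ a : C, x a = 0 ↔ a ∈ m := by
  let _ : Field (C ⧸ m) := Ideal.Quotient.field m
  have : Module.Finite k (C ⧸ m) := finite_of_finite_type_of_isJacobsonRing k (C ⧸ m)
  let φ : k ≃ₐ[k] (C ⧸ m) := AlgEquiv.ofBijective (Algebra.ofId k (C ⧸ m))
    IsAlgClosed.algebraMap_bijective_of_isIntegral
  refine ⟨WithConv.toConv ((φ.symm : (C ⧸ m) →ₐ[k] k).comp (Ideal.Quotient.mkₐ k m)), fun a => ?_⟩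
  change φ.symm (Ideal.Quotient.mk m a) = 0 ↔ _
  rw [EmbeddingLike.map_eq_zero_iff, Ideal.Quotient.eq_zero_iff_mem]

theorem mem_radical_of_forall {I : Ideal C} {a : C}
    (h : ∀ x : Points k C, (∀ b ∈ I, x b = 0) → x a = 0) : a ∈ I.radical := by
  have : IsJacobsonRing C := isJacobsonRing_of_finiteType (A := k)
  rw [Ideal.radical_eq_jacobson, Ideal.jacobson, Ideal.mem_sInf]
  rintro m ⟨hIm, hm⟩
  obtain ⟨x, hx⟩ := exists_ker_eq (k := k) m
  exact (hx a).1 (h x fun b hb => (hx b).2 (hIm hb))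

theorem ideal_eq_top {I : Ideal C} (h : ∀ x : Points k C, ∃ a ∈ I, x a ≠ 0) : I = ⊤ := by
  rw [← Ideal.radical_eq_top, Ideal.eq_top_iff_one]
  refine mem_radical_of_forall (k := k) fun x hx => ?_
  obtain ⟨a, ha, hxa⟩ := h x
  exact absurd (hx a ha) hxa

theorem sup_vanishingIdeal_eq_top {S T : Set (Points k C)} (hS : IsClosed S) (hT : IsClosed T)
    (hST : Disjoint S T) : vanishingIdeal S ⊔ vanishingIdeal T = ⊤ := by
  refine ideal_eq_top (k := k) fun x => ?_
  by_cases hx : x ∈ S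
  · obtain ⟨a, ha, hxa⟩ :=
      exists_mem_vanishingIdeal_of_notMem hT (Set.disjoint_left.1 hST hx)
    exact ⟨a, Ideal.mem_sup_right ha, hxa⟩
  · obtain ⟨a, ha, hxa⟩ := exists_mem_vanishingIdeal_of_notMem hS hx
    exact ⟨a, Ideal.mem_sup_left ha, hxa⟩

theorem eq_of_forall_apply [IsReduced C] {a b : C} (h : ∀ x : Points k C, x a = x b) : a = b := by
  have : a - b ∈ (⊥ : Ideal C).radical :=
    mem_radical_of_forall (k := k) fun x _ => by rw [map_sub, h x, sub_self]
  rw [Ideal.radical_bot_of_isReduced, Ideal.mem_bot] at this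
  exact sub_eq_zero.1 this

end Nullstellensatz

end Points

theorem isRegularOn_eval (U : Set (Points k C)) (a : C) : IsRegularOn U fun y => y a :=
  fun x _ => ⟨a, 1, by simp, fun y _ _ => by simp⟩

/-- The ideal of denominators of the function `f` on `U`: the `s` such that `s f` is the
restriction to `U` of a polynomial function. -/
def denominatorIdeal (U : Set (Points k C)) (f : Points k C → k) : Ideal C where
  carrier := {s | ∃ a : C, ∀ y ∈ U, y s * f y = y a}
  add_mem' := by
    rintro s t ⟨a, ha⟩ ⟨b, hb⟩
    exact ⟨a + b, fun y hy => by rw [map_add, map_add, ← ha y hy, ← hb y hy, add_mul]⟩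
  zero_mem' := ⟨0, fun y _ => by simp⟩
  smul_mem' := by
    rintro r s ⟨a, ha⟩
    exact ⟨r * a, fun y hy => by rw [smul_eq_mul, map_mul, map_mul, ← ha y hy, mul_assoc]⟩

namespace IsRegularOn

variable {U : Set (Points k C)} {f : Points k C → k}

theorem exists_mem_denominatorIdeal (hf : IsRegularOn U f) {x : Points k C} (hx : x ∈ U) :
    ∃ s ∈ denominatorIdeal U f, x s ≠ 0 := by
  obtain ⟨a, s, hs, has⟩ := hf x hx
  -- `s f = a` may fail where `s` vanishes, but `s² f = s a` holds everywhere on `U`.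
  refine ⟨s * s, ⟨s * a, fun y hy => ?_⟩, by rw [map_mul]; exact mul_self_ne_zero.2 hs⟩
  rcases eq_or_ne (y s) 0 with h | h
  · simp [h]
  · rw [has y hy h, map_mul, map_mul, mul_assoc, mul_div_cancel₀ _ h]

variable [IsAlgClosed k] [Algebra.FiniteType k C]

theorem exists_pow_mul_eq (hf : IsRegularOn U f) {c : C} (hc : ∀ y : Points k C, y c ≠ 0 → y ∈ U) :
    ∃ (n : ℕ) (a : C), ∀ y ∈ U, y c ^ n * f y = y a := by
  have hc' : c ∈ (denominatorIdeal U f).radical := by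
    refine Points.mem_radical_of_forall (k := k) fun x hx => by_contra fun hxc => ?_
    obtain ⟨s, hs, hxs⟩ := hf.exists_mem_denominatorIdeal (hc x hxc)
    exact hxs (hx s hs)
  obtain ⟨n, a, ha⟩ := hc'
  exact ⟨n, a, fun y hy => by rw [← ha y hy, map_pow]⟩

theorem exists_eq_eval (hf : IsRegularOn Set.univ f) : ∃ a : C, ∀ y : Points k C, f y = y a := by
  obtain ⟨n, a, ha⟩ := hf.exists_pow_mul_eq (c := 1) fun y _ => Set.mem_univ y
  exact ⟨a, fun y => by simpa using ha y (Set.mem_univ y)⟩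

end IsRegularOn

section EvalRight

variable {V W : Type*} [AddCommGroup V] [Module k V] [AddCommGroup W] [Module k W]

variable (V) in
/-- The map `v ⊗ c ↦ c(x) v` evaluating the second factor at the point `x`; an element of
`V ⊗ k[X]` is a `V`-valued polynomial function on `X`. -/
def evalRight (x : Points k C) : V ⊗[k] C →ₗ[k] V :=
  (TensorProduct.rid k V).toLinearMap ∘ₗ x.ofConv.toLinearMap.lTensor V

@[simp] theorem evalRight_tmul (x : Points k C) (v : V) (c : C) :
    evalRight V x (v ⊗ₜ c) = x c • v := by
  simp [evalRight]

theorem evalRight_rTensor (x : Points k C) (f : V →ₗ[k] W) (t : V ⊗[k] C) :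
    evalRight W x (f.rTensor C t) = f (evalRight V x t) := by
  induction t with
  | zero => simp
  | tmul v c => simp
  | add s t hs ht => simp [hs, ht]

theorem eq_of_forall_evalRight [IsAlgClosed k] [Algebra.FiniteType k C] [IsReduced C]
    {s t : V ⊗[k] C} (h : ∀ x : Points k C, evalRight V x s = evalRight V x t) : s = t := by
  classical
  let b := Module.Basis.ofVectorSpace k V
  let e := TensorProduct.equivFinsuppOfBasisLeft (N := C) b
  have eval_coord (x : Points k C) (t : V ⊗[k] C) (i) :
      x (e t i) = b.coord i (evalRight V x t) := by
    induction t with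
    | zero => simp
    | tmul v c => simp [e, mul_comm]
    | add s t hs ht => simp only [map_add, Finsupp.add_apply, hs, ht]
  refine e.injective (Finsupp.ext fun i => Points.eq_of_forall_apply (k := k) fun x => ?_)
  rw [eval_coord, eval_coord, h]

end EvalRight

end Points

/-! ### Rational modules -/

section Translations

variable {k A : Type u} [Field k] [CommRing A] [Bialgebra k A]

theorem points_mul_apply (x y : Points k A) (a : A) :
    (x * y) a = x (evalRight A y (Coalgebra.comul a)) := by
  rw [AlgHom.convMul_apply]
  generalize (Coalgebra.comul a : A ⊗[k] A) = t
  induction t with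
  | zero => simp
  | tmul v c => simp [mul_comm]
  | add s t hs ht => simp only [map_add, hs, ht]

theorem evalRight_mul {M : Type*} [AddCommGroup M] [Module k M] (x y : Points k A)
    (t : M ⊗[k] A) :
    evalRight M (x * y) t = evalRight M x (evalRight (M ⊗[k] A) y
      ((TensorProduct.assoc k M A A).symm (Coalgebra.comul.lTensor M t))) := by
  induction t with
  | zero => simp
  | tmul v c =>
    rw [evalRight_tmul, points_mul_apply, LinearMap.lTensor_tmul]
    generalize (Coalgebra.comul c : A ⊗[k] A) = s
    induction s with
    | zero => simp
    | tmul a b => simp [mul_smul]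
    | add s t hs ht => simp only [map_add, TensorProduct.tmul_add, add_smul, hs, ht]
  | add s t hs ht => simp only [map_add, hs, ht]

/-- The constant map `G → G` with value `g`, as an element of the convolution monoid of
endomorphisms of `k[G]`. -/
def constantHom (g : Points k A) : WithConv (A →ₐ[k] A) :=
  WithConv.toConv ((Algebra.ofId k A).comp g.ofConv)

/-- Left translation of functions, `(L g a) (x) = a (g x)`: the convolution of the constant map `g`
and the identity. -/
def leftTranslation (g : Points k A) : A →ₐ[k] A :=
  (constantHom g * WithConv.toConv (AlgHom.id k A)).ofConv

/-- Right translation of functions, `(R g a) (x) = a (x g)`. -/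
def rightTranslation (g : Points k A) : A →ₐ[k] A :=
  (WithConv.toConv (AlgHom.id k A) * constantHom g).ofConv

theorem comp_constantHom (f : A →ₐ[k] A) (g : Points k A) :
    f.comp (constantHom g).ofConv = (constantHom g).ofConv := by
  ext a
  simp [constantHom, Algebra.ofId_apply]

theorem point_comp_constantHom (x g : Points k A) :
    x.ofConv.comp (constantHom g).ofConv = g.ofConv := by
  ext a
  simp [constantHom, Algebra.ofId_apply]

@[simp] theorem apply_leftTranslation (g x : Points k A) (a : A) :
    x (leftTranslation g a) = (g * x) a := by
  have h : x.ofConv.comp (leftTranslation g) = (g * x).ofConv := by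
    rw [leftTranslation, AlgHom.comp_convMul_distrib, point_comp_constantHom]
    rfl
  exact DFunLike.congr_fun h a

@[simp] theorem apply_rightTranslation (g x : Points k A) (a : A) :
    x (rightTranslation g a) = (x * g) a := by
  have h : x.ofConv.comp (rightTranslation g) = (x * g).ofConv := by
    rw [rightTranslation, AlgHom.comp_convMul_distrib, point_comp_constantHom]
    rfl
  exact DFunLike.congr_fun h a

theorem rightTranslation_leftTranslation (x g : Points k A) (a : A) :
    rightTranslation x (leftTranslation g a) = leftTranslation g (rightTranslation x a) := by
  have h : (rightTranslation x).comp (leftTranslation g) =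
      (leftTranslation g).comp (rightTranslation x) := by
    rw [leftTranslation, AlgHom.comp_convMul_distrib, ← leftTranslation, comp_constantHom,
      rightTranslation, AlgHom.comp_convMul_distrib, comp_constantHom]
    exact congrArg WithConv.ofConv (mul_assoc _ (WithConv.toConv (AlgHom.id k A)) _).symm
  exact DFunLike.congr_fun h a

theorem evalRight_comul (x : Points k A) (a : A) :
    evalRight A x (Coalgebra.comul a) = rightTranslation x a := by
  rw [rightTranslation, AlgHom.convMul_apply]
  generalize (Coalgebra.comul a : A ⊗[k] A) = t
  induction t with
  | zero => simp
  | tmul v c => simp [constantHom, Algebra.ofId_apply, Algebra.smul_def, mul_comm]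
  | add s t hs ht => simp only [map_add, hs, ht]

end Translations

section HopfAlgebras

variable {k A B : Type u} [Field k] [CommRing A] [HopfAlgebra k A] [CommRing B] [HopfAlgebra k B]

theorem points_inv_apply (x : Points k A) (a : A) : x⁻¹ a = x (HopfAlgebra.antipode k a) := rfl

theorem inclusion_apply (π : A →ₐc[k] B) (x : Points k B) (a : A) :
    inclusion π x a = x (π a) := rfl

theorem map_rightTranslation (π : A →ₐc[k] B) (x : Points k B) (a : A) :
    π (rightTranslation (inclusion π x) a) = rightTranslation x (π a) := by
  have h : (π : A →ₐ[k] B).comp (rightTranslation (inclusion π x)) =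
      (rightTranslation x).comp (π : A →ₐ[k] B) := by
    rw [rightTranslation, rightTranslation, AlgHom.comp_convMul_distrib,
      AlgHom.convMul_comp_bialgHom_distrib]
    congr 3
    ext a
    exact AlgHomClass.commutes π _
  exact DFunLike.congr_fun h a

end HopfAlgebras

namespace RationalAction

variable {k B : Type u} [Field k] [CommRing B] [HopfAlgebra k B]
variable {M : Type u} [AddCommGroup M] [Module k M]

theorem act_apply (ρ : RationalAction k B M) (x : Points k B) (m : M) :
    ρ.act x m = evalRight M x (ρ.coact m) := rfl

theorem act_one (ρ : RationalAction k B M) (m : M) : ρ.act 1 m = m :=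
  LinearMap.congr_fun ρ.counit_comp m

theorem act_mul (ρ : RationalAction k B M) (x y : Points k B) (m : M) :
    ρ.act (x * y) m = ρ.act x (ρ.act y m) := by
  have hcoassoc := LinearMap.congr_fun ρ.coassoc m
  simp only [LinearMap.comp_apply, LinearEquiv.coe_coe] at hcoassoc
  rw [act_apply, evalRight_mul, ← hcoassoc, LinearEquiv.symm_apply_apply, evalRight_rTensor]
  rfl

/-- The representation of the abstract group of points underlying a rational module. -/
def toRepresentation (ρ : RationalAction k B M) : Representation k (Points k B) M where
  toFun := ρ.act
  map_one' := LinearMap.ext ρ.act_one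
  map_mul' x y := LinearMap.ext (ρ.act_mul x y)

theorem act_act_inv (ρ : RationalAction k B M) (x : Points k B) (m : M) :
    ρ.act x (ρ.act x⁻¹ m) = m := by
  rw [← act_mul, mul_inv_cancel, act_one]

/-- The element `∑ m₀ ⊗ S m₁`, i.e. the function `x ↦ x⁻¹ m`. -/
def coactInv (ρ : RationalAction k B M) : M →ₗ[k] M ⊗[k] B :=
  (HopfAlgebra.antipode k (A := B)).lTensor M ∘ₗ ρ.coact

theorem evalRight_coactInv (ρ : RationalAction k B M) (x : Points k B) (m : M) :
    evalRight M x (ρ.coactInv m) = ρ.act x⁻¹ m := by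
  rw [act_apply, coactInv, LinearMap.comp_apply]
  generalize ρ.coact m = t
  induction t with
  | zero => simp
  | tmul v c => simp [points_inv_apply]
  | add s t hs ht => simp only [map_add, hs, ht]

theorem regular_act (x : Points k B) (b : B) : (regular k B).act x b = rightTranslation x b :=
  evalRight_comul x b

section IsAlgClosed

variable [IsAlgClosed k] [Algebra.FiniteType k B] [IsReduced B]

/-- The rational action defined by a representation of the group of points whose orbit maps
`x ↦ x · m` are polynomial functions. -/
def ofRepresentation (a : Representation k (Points k B) M)
    (h : ∀ m, ∃ t : M ⊗[k] B, ∀ x, evalRight M x t = a x m) : RationalAction k B M where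
  coact :=
    { toFun := fun m => (h m).choose
      map_add' := fun m n => eq_of_forall_evalRight fun x => by
        rw [map_add, (h m).choose_spec, (h n).choose_spec, (h (m + n)).choose_spec, map_add]
      map_smul' := fun c m => eq_of_forall_evalRight fun x => by
        rw [RingHom.id_apply, map_smul, (h m).choose_spec, (h (c • m)).choose_spec, map_smul] }
  coassoc := by
    ext m
    simp only [LinearMap.comp_apply, LinearEquiv.coe_coe, LinearMap.coe_mk, AddHom.coe_mk]
    rw [← LinearEquiv.eq_symm_apply]
    refine eq_of_forall_evalRight fun y => eq_of_forall_evalRight fun x => ?_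
    rw [← evalRight_mul, evalRight_rTensor, (h m).choose_spec, (h m).choose_spec, map_mul]
    exact (h (a y m)).choose_spec x
  counit_comp := by
    ext m
    change evalRight M 1 (h m).choose = m
    rw [(h m).choose_spec, map_one, Module.End.one_apply]

@[simp] theorem ofRepresentation_act (a : Representation k (Points k B) M)
    (h : ∀ m, ∃ t : M ⊗[k] B, ∀ x, evalRight M x t = a x m) (x : Points k B) (m : M) :
    (ofRepresentation a h).act x m = a x m :=
  (h m).choose_spec x

theorem coactInv_of_mem_invariants (ρ : RationalAction k B M) {m : M} (hm : m ∈ ρ.invariants) :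
    ρ.coactInv m = m ⊗ₜ 1 :=
  eq_of_forall_evalRight fun x => by
    rw [evalRight_coactInv, evalRight_tmul, map_one, one_smul, hm]

end IsAlgClosed

/-- The subrepresentation generated by the set `s`. -/
def stableSpan (ρ : RationalAction k B M) (s : Set M) :
    Subrepresentation ρ.toRepresentation where
  toSubmodule := Submodule.span k {n | ∃ x, ∃ m ∈ s, ρ.act x m = n}
  apply_mem_toSubmodule x m hm := by
    induction hm using Submodule.span_induction with
    | mem n hn =>
      obtain ⟨y, m, hm, rfl⟩ := hn
      exact Submodule.subset_span ⟨x * y, m, hm, ρ.act_mul x y m⟩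
    | zero => simp
    | add m n _ _ hm hn => rw [map_add]; exact add_mem hm hn
    | smul c m _ hm => rw [map_smul]; exact Submodule.smul_mem _ c hm

theorem subset_stableSpan (ρ : RationalAction k B M) (s : Set M) :
    s ⊆ (ρ.stableSpan s).toSubmodule :=
  fun m hm => Submodule.subset_span ⟨1, m, hm, ρ.act_one m⟩

theorem finiteDimensional_stableSpan (ρ : RationalAction k B M) {s : Set M} (hs : s.Finite) :
    FiniteDimensional k (ρ.stableSpan s).toSubmodule := by
  choose t ht using fun m => TensorProduct.exists_finset (ρ.coact m)
  let T : Set M := ⋃ m ∈ s, Prod.fst '' (t m : Set (M × B))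
  have hT : T.Finite := hs.biUnion fun m _ => (t m).finite_toSet.image _
  have := FiniteDimensional.span_of_finite k hT
  refine Submodule.finiteDimensional_of_le (S₂ := Submodule.span k T) (Submodule.span_le.2 ?_)
  rintro _ ⟨x, m, hm, rfl⟩
  rw [act_apply, ht, map_sum]
  refine sum_mem fun p hp => ?_
  rw [evalRight_tmul]
  exact Submodule.smul_mem _ _
    (Submodule.subset_span (Set.mem_biUnion hm (Set.mem_image_of_mem _ hp)))

end RationalAction

section CoordinateAction

variable {k A B : Type u} [Field k] [CommRing A] [HopfAlgebra k A] [CommRing B] [HopfAlgebra k B]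
variable (π : A →ₐc[k] B)

theorem coordinateAction_act (x : Points k B) (a : A) :
    (coordinateAction π).act x a = rightTranslation (inclusion π x) a := by
  change evalRight A x ((π : A →ₗ[k] B).lTensor A (Coalgebra.comul a)) = _
  rw [← evalRight_comul]
  generalize (Coalgebra.comul a : A ⊗[k] A) = t
  induction t with
  | zero => simp
  | tmul v c => simp [inclusion]
  | add s t hs ht => simp only [map_add, hs, ht]

theorem apply_coordinateAction_act (x : Points k B) (y : Points k A) (a : A) :
    y ((coordinateAction π).act x a) = (y * inclusion π x) a := by
  rw [coordinateAction_act, apply_rightTranslation]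

theorem map_coordinateAction_act (x : Points k B) (a : A) :
    π ((coordinateAction π).act x a) = (RationalAction.regular k B).act x (π a) := by
  rw [coordinateAction_act, RationalAction.regular_act, map_rightTranslation]

theorem coordinateAction_act_mul (x : Points k B) (a b : A) :
    (coordinateAction π).act x (a * b) =
      (coordinateAction π).act x a * (coordinateAction π).act x b := by
  simp only [coordinateAction_act, map_mul]

theorem coordinateAction_act_one (x : Points k B) : (coordinateAction π).act x 1 = 1 := by
  rw [coordinateAction_act, map_one]

theorem coordinateAction_act_leftTranslation (x : Points k B) (g : Points k A) (a : A) :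
    (coordinateAction π).act x (leftTranslation g a) =
      leftTranslation g ((coordinateAction π).act x a) := by
  simp only [coordinateAction_act, rightTranslation_leftTranslation]

/-- The algebra `k[G]^H` of functions on `G` which are invariant under `H`. -/
def invariantSubalgebra : Subalgebra k A where
  carrier := {a | a ∈ (coordinateAction π).invariants}
  mul_mem' ha hb x := by rw [coordinateAction_act_mul, ha x, hb x]
  add_mem' ha hb := (coordinateAction π).invariants.add_mem ha hb
  algebraMap_mem' c x := by
    rw [Algebra.algebraMap_eq_smul_one, map_smul, coordinateAction_act_one]

theorem mem_invariantSubalgebra_iff [IsAlgClosed k] [Algebra.FiniteType k A] [IsReduced A]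
    {a : A} : a ∈ invariantSubalgebra π ↔
      ∀ (y : Points k A) (x : Points k B), (y * inclusion π x) a = y a := by
  refine ⟨fun h y x => ?_, fun h x => Points.eq_of_forall_apply (k := k) fun y => ?_⟩
  · rw [← apply_coordinateAction_act, h]
  · rw [apply_coordinateAction_act, h]

end CoordinateAction

/-! ### Averaging with local integrals -/

section Averaging

variable {k A B : Type u} [Field k] [CommRing A] [HopfAlgebra k A] [CommRing B] [HopfAlgebra k B]
variable {π : A →ₐc[k] B}

/-- The linear map `m ⊗ b ↦ σ(b) m` induced by `σ : B → A` on an `A`-module `M`. -/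
def smulVia {k A B : Type*} [CommSemiring k] [Semiring A] [Algebra k A] [AddCommMonoid B]
    [Module k B] (σ : B →ₗ[k] A) (M : Type*) [AddCommMonoid M] [Module k M] [Module A M]
    [IsScalarTower k A M] : M ⊗[k] B →ₗ[k] M :=
  TensorProduct.lift ((Algebra.lsmul k k M).toLinearMap ∘ₗ σ).flip

@[simp] theorem smulVia_tmul {k A B : Type*} [CommSemiring k] [Semiring A] [Algebra k A]
    [AddCommMonoid B] [Module k B] (σ : B →ₗ[k] A) {M : Type*} [AddCommMonoid M] [Module k M]
    [Module A M] [IsScalarTower k A M] (m : M) (b : B) : smulVia σ M (m ⊗ₜ b) = σ b • m := rfl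

namespace EquivariantModule

/-- The operator `m ↦ ∑ σ(S m₁) m₀`; it is a projection onto the invariants if `σ` is a total
integral. -/
def average (M : EquivariantModule π) (σ : B →ₗ[k] A) : M.carrier →ₗ[k] M.carrier :=
  smulVia σ M.carrier ∘ₗ M.action.coactInv

variable [IsAlgClosed k] [Algebra.FiniteType k B] [IsReduced B]

theorem map_act_coactInv (M : EquivariantModule π) (x : Points k B) (m : M.carrier) :
    TensorProduct.map (M.action.act x) ((RationalAction.regular k B).act x)
      (M.action.coactInv m) = M.action.coactInv m := by
  refine eq_of_forall_evalRight fun y => ?_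
  have h (t : M.carrier ⊗[k] B) :
      evalRight _ y (TensorProduct.map (M.action.act x) ((RationalAction.regular k B).act x) t) =
        M.action.act x (evalRight _ (y * x) t) := by
    induction t with
    | zero => simp
    | tmul v c => simp [RationalAction.regular_act]
    | add s t hs ht => simp only [map_add, hs, ht]
  rw [h, RationalAction.evalRight_coactInv, RationalAction.evalRight_coactInv, mul_inv_rev,
    RationalAction.act_mul, RationalAction.act_act_inv]

theorem average_mem_invariants (M : EquivariantModule π) {σ : B →ₗ[k] A} {m : M.carrier}
    {t : Finset (M.carrier × B)} (ht : M.action.coactInv m = ∑ p ∈ t, p.1 ⊗ₜ p.2)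
    (hσ : ∀ p ∈ t, ∀ x, σ ((RationalAction.regular k B).act x p.2) =
      (coordinateAction π).act x (σ p.2)) :
    M.average σ m ∈ M.invariants := by
  intro x
  calc M.action.act x (M.average σ m)
      = ∑ p ∈ t, σ ((RationalAction.regular k B).act x p.2) • M.action.act x p.1 := by
        rw [average, LinearMap.comp_apply, ht, map_sum, map_sum]
        exact Finset.sum_congr rfl fun p hp => by rw [smulVia_tmul, M.act_smul, hσ p hp]
    _ = smulVia σ _ (TensorProduct.map (M.action.act x) ((RationalAction.regular k B).act x)
          (M.action.coactInv m)) := by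
        simp only [ht, map_sum, TensorProduct.map_tmul, smulVia_tmul]
    _ = M.average σ m := by rw [map_act_coactInv, average, LinearMap.comp_apply]

theorem average_of_mem_invariants (M : EquivariantModule π) {σ : B →ₗ[k] A} (hσ : σ 1 = 1)
    {m : M.carrier} (hm : m ∈ M.invariants) : M.average σ m = m := by
  rw [average, LinearMap.comp_apply, RationalAction.coactInv_of_mem_invariants _ hm, smulVia_tmul,
    hσ, one_smul]

theorem Hom.coactInv_map {M N : EquivariantModule π} (f : M.Hom N) (m : M.carrier) :
    N.action.coactInv (f.toLinearMap m) =
      (f.toLinearMap.restrictScalars k).rTensor B (M.action.coactInv m) :=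
  eq_of_forall_evalRight fun x => by
    rw [RationalAction.evalRight_coactInv, evalRight_rTensor, RationalAction.evalRight_coactInv]
    exact (f.map_act x⁻¹ m).symm

theorem Hom.map_average {M N : EquivariantModule π} (f : M.Hom N) (σ : B →ₗ[k] A)
    (m : M.carrier) : f.toLinearMap (M.average σ m) = N.average σ (f.toLinearMap m) := by
  rw [average, average, LinearMap.comp_apply, LinearMap.comp_apply, f.coactInv_map]
  generalize M.action.coactInv m = t
  induction t with
  | zero => simp
  | tmul v c => simp
  | add s t hs ht => simp only [map_add, hs, ht]

end EquivariantModule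

/-- A weak form of the existence of a total integral: there are linear maps `σ` with `σ 1 = 1`
which are equivariant on any given finite set. -/
def HasLocalIntegrals (π : A →ₐc[k] B) : Prop :=
  ∀ s : Set B, s.Finite → ∃ σ : B →ₗ[k] A, σ 1 = 1 ∧ ∀ b ∈ s, ∀ x,
    σ ((RationalAction.regular k B).act x b) = (coordinateAction π).act x (σ b)

theorem IsTotalIntegral.hasLocalIntegrals {σ : B →ₗ[k] A} (hσ : IsTotalIntegral π σ) :
    HasLocalIntegrals π :=
  fun _ _ => ⟨σ, hσ.map_one, fun b _ x => hσ.map_act x b⟩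

namespace EquivariantModule.Hom

variable {P Q R : EquivariantModule π} {f : P.Hom Q} {g : Q.Hom R}

theorem onInvariants_injective (hf : Function.Injective f.toLinearMap) :
    Function.Injective f.onInvariants :=
  fun _ _ h => Subtype.ext (hf (congrArg Subtype.val h))

theorem onInvariants_exact (hf : Function.Injective f.toLinearMap)
    (hfg : Function.Exact f.toLinearMap g.toLinearMap) :
    Function.Exact f.onInvariants g.onInvariants := by
  refine fun q => ⟨fun hq => ?_, ?_⟩
  · obtain ⟨p, hp⟩ := (hfg q).1 (congrArg Subtype.val hq)
    exact ⟨⟨p, fun x => hf (by rw [f.map_act, hp, q.2 x])⟩, Subtype.ext hp⟩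
  · rintro ⟨p, rfl⟩
    exact Subtype.ext ((hfg _).2 ⟨p, rfl⟩)

theorem onInvariants_surjective [IsAlgClosed k] [Algebra.FiniteType k B] [IsReduced B]
    (h : HasLocalIntegrals π) (hg : Function.Surjective g.toLinearMap) :
    Function.Surjective g.onInvariants := by
  intro r
  obtain ⟨q, hq⟩ := hg r
  obtain ⟨t, ht⟩ := TensorProduct.exists_finset (Q.action.coactInv q)
  obtain ⟨σ, hσ₁, hσ⟩ := h (Prod.snd '' (t : Set (Q.carrier × B))) (t.finite_toSet.image _)
  refine ⟨⟨Q.average σ q, Q.average_mem_invariants ht fun p hp =>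
    hσ p.2 (Set.mem_image_of_mem _ hp)⟩, Subtype.ext ?_⟩
  change g.toLinearMap (Q.average σ q) = r
  rw [g.map_average, hq, R.average_of_mem_invariants hσ₁ r.2]

end EquivariantModule.Hom

theorem HasLocalIntegrals.isExactSubgroup [IsAlgClosed k] [Algebra.FiniteType k B] [IsReduced B]
    (h : HasLocalIntegrals π) : IsExactSubgroup π :=
  fun _ _ _ _ _ hf hfg hg =>
    ⟨EquivariantModule.Hom.onInvariants_injective hf,
      EquivariantModule.Hom.onInvariants_exact hf hfg,
      EquivariantModule.Hom.onInvariants_surjective h hg⟩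

end Averaging

/-! ### Exactness gives a total integral -/

section LinearMaps

variable {k B : Type u} [Field k] [CommRing B] [HopfAlgebra k B]

theorem exists_evalRight_eq_of_forall_apply {k C : Type u} [Field k] [CommRing C] [Algebra k C]
    {V W : Type*} [AddCommGroup V] [Module k V] [FiniteDimensional k V] [AddCommGroup W]
    [Module k W] {F : Points k C → V →ₗ[k] W}
    (hF : ∀ v, ∃ t : W ⊗[k] C, ∀ x, evalRight W x t = F x v) :
    ∃ t : (V →ₗ[k] W) ⊗[k] C, ∀ x, evalRight _ x t = F x := by
  choose t ht using hF
  let b := Module.finBasis k V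
  refine ⟨∑ j, (LinearMap.smulRightₗ (b.coord j)).rTensor C (t (b j)), fun x => b.ext fun j => ?_⟩
  simp only [map_sum, evalRight_rTensor, ht, LinearMap.sum_apply, LinearMap.smulRightₗ_apply]
  rw [Finset.sum_eq_single j (fun i _ hij => by simp [hij.symm]) (by simp)]
  simp

theorem evalRight_lTensor_mulLeft {k C V : Type u} [Field k] [CommRing C] [Algebra k C]
    [AddCommGroup V] [Module k V] (x : Points k C) (c : C) (t : V ⊗[k] C) :
    evalRight V x ((LinearMap.mulLeft k c).lTensor V t) = x c • evalRight V x t := by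
  induction t with
  | zero => simp
  | tmul v d => simp [mul_smul]
  | add s t hs ht => simp only [map_add, smul_add, hs, ht]

namespace RationalAction

variable {V W : Type u} [AddCommGroup V] [Module k V] [AddCommGroup W] [Module k W]

theorem exists_evalRight_eq_linHom [FiniteDimensional k V] (ρ : RationalAction k B V)
    (ρ' : RationalAction k B W) (φ : V →ₗ[k] W) :
    ∃ t : (V →ₗ[k] W) ⊗[k] B, ∀ x, evalRight _ x t =
      Representation.linHom ρ.toRepresentation ρ'.toRepresentation x φ := by
  refine exists_evalRight_eq_of_forall_apply fun v => ?_
  obtain ⟨s, hs⟩ := TensorProduct.exists_finset (ρ.coactInv v)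
  refine ⟨∑ p ∈ s, (LinearMap.mulLeft k p.2).lTensor W (ρ'.coact (φ p.1)), fun x => ?_⟩
  change _ = ρ'.act x (φ (ρ.act x⁻¹ v))
  rw [← evalRight_coactInv, hs]
  simp only [map_sum, evalRight_lTensor_mulLeft, evalRight_tmul, map_smul, act_apply]

variable [IsAlgClosed k] [Algebra.FiniteType k B] [IsReduced B]

/-- The rational module of linear maps from a finite dimensional rational module `V` to a rational
module `W`, with `x · φ = x φ x⁻¹`. -/
def linHom [FiniteDimensional k V] (ρ : RationalAction k B V) (ρ' : RationalAction k B W) :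
    RationalAction k B (V →ₗ[k] W) :=
  ofRepresentation _ (exists_evalRight_eq_linHom ρ ρ')

theorem linHom_act [FiniteDimensional k V] (ρ : RationalAction k B V) (ρ' : RationalAction k B W)
    (x : Points k B) (φ : V →ₗ[k] W) : (ρ.linHom ρ').act x φ = ρ'.act x ∘ₗ φ ∘ₗ ρ.act x⁻¹ :=
  ofRepresentation_act _ _ x φ

theorem mem_invariants_linHom [FiniteDimensional k V] (ρ : RationalAction k B V)
    (ρ' : RationalAction k B W) {φ : V →ₗ[k] W} : φ ∈ (ρ.linHom ρ').invariants ↔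
      ρ.toRepresentation.IsIntertwiningMap ρ'.toRepresentation φ := by
  rw [← Representation.mem_linHom_invariants_iff_isIntertwining]
  exact forall_congr' fun x => by rw [linHom_act]; rfl

/-- The restriction of a rational action to a stable subspace. -/
def ofSubrepresentation (ρ : RationalAction k B V) (P : Subrepresentation ρ.toRepresentation) :
    RationalAction k B P.toSubmodule :=
  ofRepresentation P.toRepresentation fun v => by
    obtain ⟨q, hq⟩ :=
      P.toSubmodule.subtype.exists_leftInverse_of_injective P.toSubmodule.ker_subtype
    refine ⟨q.rTensor B (ρ.coact v), fun x => ?_⟩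
    rw [evalRight_rTensor]
    exact LinearMap.congr_fun hq (P.toRepresentation x v)

theorem coe_ofSubrepresentation_act (ρ : RationalAction k B V)
    (P : Subrepresentation ρ.toRepresentation) (x : Points k B) (v : P.toSubmodule) :
    ((ρ.ofSubrepresentation P).act x v : V) = ρ.act x v :=
  congrArg Subtype.val (ofRepresentation_act _ _ x v)

end RationalAction

end LinearMaps

section Injectivity

variable {k A B : Type u} [Field k] [IsAlgClosed k] [CommRing A] [HopfAlgebra k A] [CommRing B]
  [HopfAlgebra k B] [Algebra.FiniteType k B] [IsReduced B] {π : A →ₐc[k] B}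

namespace EquivariantModule

/-- A stable `k[G]`-submodule of a `(k[G], H)`-module, as a `(k[G], H)`-module. -/
def ofSubmodule (M : EquivariantModule π) (P : Submodule A M.carrier)
    (hP : ∀ x, ∀ m ∈ P, M.action.act x m ∈ P) : EquivariantModule π where
  carrier := P
  moduleBase := (P.restrictScalars k).module
  isScalarTower := ⟨fun a b m => Subtype.ext (smul_assoc a b (m : M.carrier))⟩
  action := M.action.ofSubrepresentation ⟨P.restrictScalars k, hP⟩
  act_smul x r m := Subtype.ext <| by
    refine (M.action.coe_ofSubrepresentation_act _ _ _).trans ((M.act_smul x r m).trans ?_)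
    exact congrArg _
      (M.action.coe_ofSubrepresentation_act ⟨P.restrictScalars k, hP⟩ x m).symm

/-- The inclusion of a stable `k[G]`-submodule. -/
def subtype (M : EquivariantModule π) (P : Submodule A M.carrier)
    (hP : ∀ x, ∀ m ∈ P, M.action.act x m ∈ P) : (M.ofSubmodule P hP).Hom M where
  toLinearMap := P.subtype
  map_act x m := M.action.coe_ofSubrepresentation_act ⟨P.restrictScalars k, hP⟩ x m

end EquivariantModule

theorem IsExactSubgroup.onInvariants_surjective (hex : IsExactSubgroup π)
    {Q R : EquivariantModule π} (g : Q.Hom R) (hg : Function.Surjective g.toLinearMap) :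
    Function.Surjective g.onInvariants := by
  have hker : ∀ x, ∀ m ∈ LinearMap.ker g.toLinearMap,
      Q.action.act x m ∈ LinearMap.ker g.toLinearMap := fun x m hm => by
    rw [LinearMap.mem_ker] at hm ⊢
    rw [g.map_act, hm, map_zero]
  exact (hex _ _ _ (Q.subtype _ hker) g (Submodule.injective_subtype _)
    (LinearMap.exact_subtype_ker_map _) hg).2.2

/-- The `(k[G], H)`-module of linear maps from a finite dimensional rational `H`-module to
`k[G]`. -/
def homModule (π : A →ₐc[k] B) {V : Type u} [AddCommGroup V] [Module k V] [FiniteDimensional k V]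
    (ρ : RationalAction k B V) : EquivariantModule π where
  carrier := V →ₗ[k] A
  action := ρ.linHom (coordinateAction π)
  act_smul x r φ := by
    ext v
    simp only [RationalAction.linHom_act, LinearMap.comp_apply, LinearMap.smul_apply, smul_eq_mul,
      coordinateAction_act_mul]

variable {U V : Type u} [AddCommGroup U] [Module k U] [FiniteDimensional k U] [AddCommGroup V]
  [Module k V] [FiniteDimensional k V] {ρ : RationalAction k B U} {ρ' : RationalAction k B V}

/-- Precomposition with an equivariant map, as a morphism of `(k[G], H)`-modules. -/
def homModuleComap (π : A →ₐc[k] B) {j : U →ₗ[k] V}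
    (hj : ρ.toRepresentation.IsIntertwiningMap ρ'.toRepresentation j) :
    (homModule π ρ').Hom (homModule π ρ) where
  toLinearMap := LinearMap.lcomp A A j
  map_act x (φ : V →ₗ[k] A) := LinearMap.ext fun v => by
    change (ρ'.linHom (coordinateAction π)).act x φ (j v) =
      (ρ.linHom (coordinateAction π)).act x (LinearMap.lcomp A A j φ) v
    simp only [RationalAction.linHom_act, LinearMap.comp_apply]
    exact congrArg _ (congrArg φ (hj.isIntertwining x⁻¹ v).symm)

theorem IsExactSubgroup.exists_intertwining_extension (hex : IsExactSubgroup π) {j : U →ₗ[k] V}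
    (hj : ρ.toRepresentation.IsIntertwiningMap ρ'.toRepresentation j)
    (hj_inj : Function.Injective j) {φ : U →ₗ[k] A}
    (hφ : ρ.toRepresentation.IsIntertwiningMap (coordinateAction π).toRepresentation φ) :
    ∃ ψ : V →ₗ[k] A, ρ'.toRepresentation.IsIntertwiningMap (coordinateAction π).toRepresentation ψ ∧
      ψ ∘ₗ j = φ := by
  have hsurj : Function.Surjective (homModuleComap π hj).toLinearMap := fun (φ : U →ₗ[k] A) => by
    obtain ⟨q, hq⟩ := j.exists_leftInverse_of_injective (LinearMap.ker_eq_bot.2 hj_inj)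
    refine ⟨φ ∘ₗ q, ?_⟩
    change (φ ∘ₗ q) ∘ₗ j = φ
    rw [LinearMap.comp_assoc, hq, LinearMap.comp_id]
  obtain ⟨⟨ψ, hψ⟩, hψφ⟩ := hex.onInvariants_surjective (homModuleComap π hj) hsurj
    ⟨φ, (ρ.mem_invariants_linHom _).2 hφ⟩
  exact ⟨ψ, (ρ'.mem_invariants_linHom _).1 hψ, congrArg Subtype.val hψφ⟩

end Injectivity

section PartialMaps

variable {k B M N : Type u} [Field k] [CommRing B] [HopfAlgebra k B] [AddCommGroup M] [Module k M]
  [AddCommGroup N] [Module k N] {ρ : RationalAction k B M} {ρ' : RationalAction k B N}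

/-- A linear map between rational modules, defined on a stable subspace only, is equivariant. -/
def IsEquivariantPMap (ρ : RationalAction k B M) (ρ' : RationalAction k B N)
    (f : M →ₗ.[k] N) : Prop :=
  ∀ x (m : f.domain), ∃ h : ρ.act x m ∈ f.domain, f ⟨_, h⟩ = ρ'.act x (f m)

namespace IsEquivariantPMap

theorem exists_upperBound {c : Set (M →ₗ.[k] N)} (hc : ∀ f ∈ c, IsEquivariantPMap ρ ρ' f)
    (hchain : IsChain (· ≤ ·) c) (hne : c.Nonempty) :
    ∃ g, IsEquivariantPMap ρ ρ' g ∧ ∀ f ∈ c, f ≤ g := by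
  refine ⟨LinearPMap.sSup c hchain.directedOn, fun x m => ?_,
    fun f hf => LinearPMap.le_sSup hchain.directedOn hf⟩
  obtain ⟨f, hf, hm⟩ := (LinearPMap.mem_domain_sSup_iff hne hchain.directedOn).1 m.2
  obtain ⟨h, hx⟩ := hc f hf x ⟨m, hm⟩
  refine ⟨(LinearPMap.le_sSup hchain.directedOn hf).1 h, ?_⟩
  have h₁ := LinearPMap.sSup_apply hchain.directedOn hf ⟨_, h⟩
  have h₂ := LinearPMap.sSup_apply hchain.directedOn hf ⟨m, hm⟩
  rw [h₁, hx, ← h₂]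

theorem sup {f g : M →ₗ.[k] N} (hf : IsEquivariantPMap ρ ρ' f) (hg : IsEquivariantPMap ρ ρ' g)
    (h : ∀ (x : f.domain) (y : g.domain), (x : M) = y → f x = g y) :
    IsEquivariantPMap ρ ρ' (f.sup g h) := by
  intro x m
  obtain ⟨y, hy, z, hz, hyz⟩ := Submodule.mem_sup.1 m.2
  obtain ⟨hfy, ey⟩ := hf x ⟨y, hy⟩
  obtain ⟨hgz, ez⟩ := hg x ⟨z, hz⟩
  have hm : ρ.act x m ∈ f.domain ⊔ g.domain := by
    rw [← hyz, map_add]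
    exact Submodule.add_mem_sup hfy hgz
  refine ⟨hm, ?_⟩
  refine (LinearPMap.sup_apply h ⟨_, hfy⟩ ⟨_, hgz⟩ ⟨_, hm⟩ (by simp [← hyz])).trans ?_
  rw [ey, ez, ← map_add]
  exact congrArg _ (LinearPMap.sup_apply h ⟨y, hy⟩ ⟨z, hz⟩ m hyz).symm

/-- The domain of an equivariant partial map, as a subrepresentation. -/
def domain {f : M →ₗ.[k] N} (hf : IsEquivariantPMap ρ ρ' f) :
    Subrepresentation ρ.toRepresentation :=
  ⟨f.domain, fun x m hm => (hf x ⟨m, hm⟩).1⟩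

end IsEquivariantPMap

end PartialMaps

section Extension

variable {k A B M : Type u} [Field k] [IsAlgClosed k] [CommRing A] [HopfAlgebra k A] [CommRing B]
  [HopfAlgebra k B] [Algebra.FiniteType k B] [IsReduced B] {π : A →ₐc[k] B} [AddCommGroup M]
  [Module k M] {ρ : RationalAction k B M}

theorem IsExactSubgroup.exists_le_mem_domain (hex : IsExactSubgroup π) {f : M →ₗ.[k] A}
    (hf : IsEquivariantPMap ρ (coordinateAction π) f) (m : M) :
    ∃ g, IsEquivariantPMap ρ (coordinateAction π) g ∧ f ≤ g ∧ m ∈ g.domain := by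
  let V := ρ.stableSpan {m}
  let U : Subrepresentation ρ.toRepresentation := hf.domain ⊓ V
  have : FiniteDimensional k V.toSubmodule :=
    ρ.finiteDimensional_stableSpan (Set.finite_singleton m)
  have : FiniteDimensional k U.toSubmodule :=
    Submodule.finiteDimensional_of_le (inf_le_right : U.toSubmodule ≤ V.toSubmodule)
  obtain ⟨ψ, hψ, hψf⟩ := hex.exists_intertwining_extension
    (ρ := ρ.ofSubrepresentation U) (ρ' := ρ.ofSubrepresentation V)
    (j := Submodule.inclusion inf_le_right) (φ := f.toFun ∘ₗ Submodule.inclusion inf_le_left)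
    ⟨fun x u => Subtype.ext <| (ρ.coe_ofSubrepresentation_act U x u).trans
      (ρ.coe_ofSubrepresentation_act V x ⟨u, u.2.2⟩).symm⟩
    (Submodule.inclusion_injective _)
    ⟨fun x u => by
      obtain ⟨h, hx⟩ := hf x ⟨u, u.2.1⟩
      refine Eq.trans (congrArg f.toFun (Subtype.ext ?_)) hx
      exact ρ.coe_ofSubrepresentation_act U x u⟩
  have hagree : ∀ (x : f.domain) (y : V.toSubmodule), (x : M) = y → f x = ψ y := by
    rintro ⟨x, hx⟩ ⟨y, hy⟩ rfl
    exact (LinearMap.congr_fun hψf ⟨x, hx, hy⟩).symm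
  have hg : IsEquivariantPMap ρ (coordinateAction π) ⟨V.toSubmodule, ψ⟩ := fun x v =>
    ⟨V.apply_mem_toSubmodule x v.2, Eq.trans
      (congrArg ψ (Subtype.ext (ρ.coe_ofSubrepresentation_act V x v).symm))
      (hψ.isIntertwining x v)⟩
  exact ⟨_, hf.sup hg hagree, LinearPMap.left_le_sup _ _ _,
    Submodule.mem_sup_right (ρ.subset_stableSpan {m} rfl)⟩

theorem IsExactSubgroup.exists_extend (hex : IsExactSubgroup π) {f : M →ₗ.[k] A}
    (hf : IsEquivariantPMap ρ (coordinateAction π) f) :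
    ∃ σ : M →ₗ[k] A, ρ.toRepresentation.IsIntertwiningMap (coordinateAction π).toRepresentation σ ∧
      ∀ m : f.domain, σ m = f m := by
  obtain ⟨g, hfg, hmax⟩ := zorn_le_nonempty₀ {g | IsEquivariantPMap ρ (coordinateAction π) g}
    (fun c hc hchain y hy => IsEquivariantPMap.exists_upperBound hc hchain ⟨y, hy⟩) f hf
  have hg : IsEquivariantPMap ρ (coordinateAction π) g := hmax.prop
  have hdom (m : M) : m ∈ g.domain := by
    obtain ⟨g', hg', hle, hm⟩ := hex.exists_le_mem_domain hg m
    exact (hmax.le_of_ge hg' hle).1 hm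
  refine ⟨g.toFun ∘ₗ LinearMap.id.codRestrict g.domain hdom, ⟨fun x m => ?_⟩, fun m => ?_⟩
  · exact (hg x ⟨m, hdom m⟩).2
  · exact (hfg.2 rfl).symm

theorem isEquivariantPMap_mkSpanSingleton {k B M N : Type u} [Field k] [CommRing B]
    [HopfAlgebra k B] [AddCommGroup M] [Module k M] [AddCommGroup N] [Module k N]
    {ρ : RationalAction k B M} {ρ' : RationalAction k B N} {m : M} (hm₀ : m ≠ 0)
    (hm : m ∈ ρ.invariants) {n : N} (hn : n ∈ ρ'.invariants) :
    IsEquivariantPMap ρ ρ' (LinearPMap.mkSpanSingleton m n hm₀) := by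
  rintro x ⟨_, hb⟩
  obtain ⟨c, rfl⟩ := Submodule.mem_span_singleton.1 hb
  have h : ρ.act x (c • m) = c • m := by rw [map_smul, hm]
  refine ⟨by rwa [h], ?_⟩
  simp only [h, LinearPMap.mkSpanSingleton'_apply, LinearPMap.mkSpanSingleton, map_smul,
    hn x, RingHom.id_apply]

theorem IsExactSubgroup.exists_isTotalIntegral (hex : IsExactSubgroup π) :
    ∃ σ : B →ₗ[k] A, IsTotalIntegral π σ := by
  have : Nontrivial B := (Bialgebra.counitAlgHom k B).toRingHom.domain_nontrivial
  have hB : (1 : B) ∈ (RationalAction.regular k B).invariants := fun x => by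
    rw [RationalAction.regular_act, map_one]
  obtain ⟨σ, hσ, hσ₁⟩ := hex.exists_extend
    (isEquivariantPMap_mkSpanSingleton one_ne_zero hB (coordinateAction_act_one π))
  refine ⟨σ, fun x b => hσ.isIntertwining x b, ?_⟩
  rw [hσ₁ ⟨1, Submodule.mem_span_singleton_self 1⟩]
  exact LinearPMap.mkSpanSingleton_apply k k one_ne_zero 1

end Extension

/-! ### Affine homogeneous spaces give local integrals -/

section Interpolation

variable {k C : Type u} [Field k] [CommRing C] [Algebra k C]

/-- The vector of values at the points `g i`, for functions in the space `W`. -/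
def evalOn (W : Submodule k C) {ι : Type*} (g : ι → Points k C) : W →ₗ[k] ι → k :=
  LinearMap.pi fun i => (g i).ofConv.toLinearMap ∘ₗ W.subtype

@[simp] theorem evalOn_apply (W : Submodule k C) {ι : Type*} (g : ι → Points k C) (w : W) (i : ι) :
    evalOn W g w i = g i w := rfl

theorem exists_evalOn_bijective [IsAlgClosed k] [Algebra.FiniteType k C] [IsReduced C]
    (W : Submodule k C) [FiniteDimensional k W] :
    ∃ g : Fin (Module.finrank k W) → Points k C, Function.Bijective (evalOn W g) := by
  let ev (x : Points k C) : Module.Dual k W := x.ofConv.toLinearMap ∘ₗ W.subtype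
  have hspan : Submodule.span k (Set.range ev) = ⊤ := by
    rw [← Subspace.dualCoannihilator_dualAnnihilator_eq (W := Submodule.span k (Set.range ev)),
      ← Submodule.dualAnnihilator_bot]
    refine congrArg _ ((Submodule.eq_bot_iff _).2 fun w hw => Subtype.ext ?_)
    refine Points.eq_of_forall_apply (k := k) fun x => ?_
    exact ((Submodule.mem_dualCoannihilator w).1 hw _
      (Submodule.subset_span ⟨x, rfl⟩)).trans (map_zero x.ofConv).symm
  let b := Module.Basis.ofSpan hspan.ge
  let e := b.indexEquiv (Module.finBasis k W).dualBasis
  choose g hg using fun i => Module.Basis.ofSpan_subset hspan.ge ⟨e.symm i, rfl⟩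
  have hinj : Function.Injective (evalOn W g) := by
    refine (injective_iff_map_eq_zero _).2 fun w hw => ?_
    refine (Module.forall_dual_apply_eq_zero_iff k w).1 fun φ => ?_
    have : Module.Dual.eval k W w = 0 := b.ext fun i => by
      obtain ⟨i, rfl⟩ := e.symm.surjective i
      rw [Module.Dual.eval_apply, ← hg i]
      exact congrFun hw i
    exact LinearMap.congr_fun this φ
  exact ⟨g, hinj, (LinearMap.injective_iff_surjective_of_finrank_eq_finrank (by simp)).1 hinj⟩

end Interpolation

section Cramer

variable {k A B : Type u} [Field k] [CommRing A] [HopfAlgebra k A] [CommRing B] [HopfAlgebra k B]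

theorem exists_sum_mul_leftTranslation_eq (W : Submodule k A) [FiniteDimensional k W]
    (g : Fin (Module.finrank k W) → Points k A) (g₀ : Points k A) :
    ∃ (d : A) (p : Fin (Module.finrank k W) → A),
      (∀ x : Points k A, x d ≠ 0 ↔ Function.Bijective (evalOn W fun j => g j * x)) ∧
      ∀ w ∈ W, ∑ j, p j * leftTranslation (g j) w = d * leftTranslation g₀ w := by
  let b := Module.finBasis k W
  let M : Matrix (Fin (Module.finrank k W)) (Fin (Module.finrank k W)) A :=
    Matrix.of fun i j => leftTranslation (g j) (b i)
  let p := M.cramer fun i => leftTranslation g₀ (b i)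
  refine ⟨M.det, p, fun x => ?_, fun w hw => ?_⟩
  · have hdet : x M.det =
        (LinearMap.toMatrix b (Pi.basisFun k _) (evalOn W fun j => g j * x)).det := by
      rw [← Matrix.det_transpose]
      refine (RingHom.map_det (x.ofConv : A →+* k) _).trans (congrArg Matrix.det ?_)
      ext j i
      simp [M, LinearMap.toMatrix_apply]
    rw [hdet, ← isUnit_iff_ne_zero]
    exact ⟨fun h => (LinearEquiv.ofIsUnitDet h).bijective,
      fun h => (LinearEquiv.ofBijective _ h).isUnit_det b _⟩
  · have h : (∑ j, LinearMap.mulLeft k (p j) ∘ₗ (leftTranslation (g j)).toLinearMap) ∘ₗ W.subtype =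
        (LinearMap.mulLeft k M.det ∘ₗ (leftTranslation g₀).toLinearMap) ∘ₗ W.subtype := by
      refine b.ext fun i => ?_
      have := congrFun (M.mulVec_cramer fun i => leftTranslation g₀ (b i)) i
      simpa [Matrix.mulVec, dotProduct, M, p, mul_comm] using this
    simpa using LinearMap.congr_fun h ⟨w, hw⟩

theorem evalOn_mul_inclusion_bijective {π : A →ₐc[k] B} {W : Submodule k A}
    (hW : ∀ x, ∀ w ∈ W, (coordinateAction π).act x w ∈ W) {ι : Type*} {g : ι → Points k A}
    (hg : Function.Bijective (evalOn W g)) (x : Points k B) :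
    Function.Bijective (evalOn W fun i => g i * inclusion π x) := by
  let P : Subrepresentation (coordinateAction π).toRepresentation := ⟨W, fun x w hw => hW x w hw⟩
  have : evalOn W (fun i => g i * inclusion π x) = evalOn W g ∘ₗ P.toRepresentation x := by
    ext w i
    exact (apply_coordinateAction_act π x (g i) w).symm
  rw [this]
  exact hg.comp (P.toRepresentation.apply_bijective x)

end Cramer

section HomogeneousSpace

variable {k A B : Type u} [Field k] [CommRing A] [HopfAlgebra k A] [CommRing B] [HopfAlgebra k B]
variable (π : A →ₐc[k] B)

theorem coe_mul_inclusion (x : Points k A) (h : Points k B) :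
    ((x * inclusion π h : Points k A) : HomogeneousSpace π) = x :=
  QuotientGroup.mk_mul_of_mem x ⟨h, rfl⟩

variable {π}

theorem eq_coe_iff {x y : Points k A} :
    (x : HomogeneousSpace π) = y ↔ ∃ h : Points k B, y = x * inclusion π h := by
  rw [QuotientGroup.eq]
  exact exists_congr fun h => eq_inv_mul_iff_mul_eq.trans eq_comm

theorem preimage_image_coe {U : Set (Points k A)}
    (hU : ∀ x ∈ U, ∀ h : Points k B, x * inclusion π h ∈ U) :
    (fun x : Points k A => (x : HomogeneousSpace π)) ⁻¹'
      ((fun x : Points k A => (x : HomogeneousSpace π)) '' U) = U := by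
  refine Set.Subset.antisymm ?_ (Set.subset_preimage_image _ U)
  rintro y ⟨x, hx, hxy⟩
  obtain ⟨h, rfl⟩ := eq_coe_iff.1 hxy
  exact hU x hx h

variable [IsAlgClosed k] [Algebra.FiniteType k A] [IsReduced A]

theorem apply_eq_of_coe_eq {c : A} (hc : c ∈ invariantSubalgebra π) {x y : Points k A}
    (hxy : (x : HomogeneousSpace π) = y) : x c = y c := by
  obtain ⟨h, rfl⟩ := eq_coe_iff.1 hxy
  exact ((mem_invariantSubalgebra_iff π).1 hc x h).symm

/-- The homeomorphism `e` identifies the regular functions on the open subsets of `G/H` with those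
on the open subsets of the affine variety with coordinate algebra `C`. -/
def IsRegularIso {C : Type u} [CommRing C] [Algebra k C]
    (e : HomogeneousSpace π ≃ₜ Points k C) : Prop :=
  ∀ U : Set (Points k C), IsOpen U → ∀ f : Points k C → k,
    IsRegularOn U f ↔ IsRegularOnQuotient π (e ⁻¹' U) (f ∘ e)

namespace IsRegularIso

variable {C : Type u} [CommRing C] [Algebra k C] {e : HomogeneousSpace π ≃ₜ Points k C}

theorem exists_pullback (he : IsRegularIso e) (a : C) :
    ∃ c ∈ invariantSubalgebra π, ∀ x : Points k A, x c = e x a := by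
  have := (he Set.univ isOpen_univ _).1 (isRegularOn_eval Set.univ a)
  obtain ⟨c, hc⟩ := IsRegularOn.exists_eq_eval
    (f := fun x : Points k A => e (x : HomogeneousSpace π) a) this
  refine ⟨c, (mem_invariantSubalgebra_iff π).2 fun y x => ?_, fun x => (hc x).symm⟩
  rw [← hc, ← hc, coe_mul_inclusion]

/-- The comorphism `k[X] → k[G]^H` of an isomorphism of `G/H` with an affine variety `X`. -/
def pullback (he : IsRegularIso e) : C →ₐ[k] invariantSubalgebra π :=
  AlgHom.codRestrict
    { toFun := fun a => (he.exists_pullback a).choose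
      map_one' := Points.eq_of_forall_apply (k := k) fun x => by
        rw [(he.exists_pullback 1).choose_spec.2, map_one, map_one]
      map_mul' := fun a b => Points.eq_of_forall_apply (k := k) fun x => by
        rw [(he.exists_pullback (a * b)).choose_spec.2, map_mul, map_mul,
          (he.exists_pullback a).choose_spec.2, (he.exists_pullback b).choose_spec.2]
      map_zero' := Points.eq_of_forall_apply (k := k) fun x => by
        rw [(he.exists_pullback 0).choose_spec.2, map_zero, map_zero]
      map_add' := fun a b => Points.eq_of_forall_apply (k := k) fun x => by
        rw [(he.exists_pullback (a + b)).choose_spec.2, map_add, map_add,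
          (he.exists_pullback a).choose_spec.2, (he.exists_pullback b).choose_spec.2]
      commutes' := fun r => Points.eq_of_forall_apply (k := k) fun x => by
        rw [(he.exists_pullback _).choose_spec.2, AlgHomClass.commutes, AlgHomClass.commutes] }
    (invariantSubalgebra π) fun a => (he.exists_pullback a).choose_spec.1

theorem apply_pullback (he : IsRegularIso e) (a : C) (x : Points k A) :
    x (he.pullback a : A) = e x a :=
  (he.exists_pullback a).choose_spec.2 x

variable [Algebra.FiniteType k C]

theorem pullback_surjective (he : IsRegularIso e) : Function.Surjective he.pullback := by
  rintro ⟨c, hc⟩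
  let f : HomogeneousSpace π → k := Quotient.lift (fun x : Points k A => x c) fun x y hxy =>
    apply_eq_of_coe_eq hc (Quotient.sound hxy)
  have hf : IsRegularOn Set.univ (f ∘ e.symm) := by
    rw [he Set.univ isOpen_univ, Function.comp_assoc, e.symm_comp_self]
    exact isRegularOn_eval _ c
  obtain ⟨a, ha⟩ := hf.exists_eq_eval
  refine ⟨a, Subtype.ext (Points.eq_of_forall_apply (k := k) fun x => ?_)⟩
  rw [apply_pullback, ← ha, Function.comp_apply, e.symm_apply_apply]
  rfl

theorem ideal_eq_top (he : IsRegularIso e) {J : Ideal (invariantSubalgebra π)}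
    (hJ : ∀ x : Points k A, ∃ c ∈ J, x (c : A) ≠ 0) : J = ⊤ := by
  have : J.comap he.pullback = ⊤ := Points.ideal_eq_top (k := k) fun y => by
    obtain ⟨x, hx⟩ := QuotientGroup.mk_surjective (e.symm y)
    obtain ⟨c, hc, hxc⟩ := hJ x
    obtain ⟨a, rfl⟩ := he.pullback_surjective c
    refine ⟨a, hc, ?_⟩
    rwa [apply_pullback, hx, e.apply_symm_apply] at hxc
  exact Ideal.comap_eq_top_iff.1 this

omit [Algebra.FiniteType k C] in
theorem exists_ne_zero_subset (he : IsRegularIso e) {U : Set (Points k A)} (hUo : IsOpen U)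
    (hU : ∀ x ∈ U, ∀ h : Points k B, x * inclusion π h ∈ U) {x : Points k A} (hx : x ∈ U) :
    ∃ c ∈ invariantSubalgebra π, x c ≠ 0 ∧ ∀ y : Points k A, y c ≠ 0 → y ∈ U := by
  have hopen : IsOpen ((fun x : Points k A => (x : HomogeneousSpace π)) '' U) :=
    isOpen_coinduced.2 ((preimage_image_coe hU).symm ▸ hUo)
  obtain ⟨a, ha, haU⟩ := Points.exists_ne_zero_subset (hopen.preimage e.symm.continuous)
    (x := e x) ⟨x, hx, (e.symm_apply_apply _).symm⟩
  refine ⟨he.pullback a, (he.pullback a).2, by rwa [apply_pullback], fun y hy => ?_⟩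
  rw [apply_pullback] at hy
  have hyU := haU _ hy
  rw [Set.mem_preimage, e.symm_apply_apply] at hyU
  rwa [← preimage_image_coe hU]

end IsRegularIso

end HomogeneousSpace

section Intertwining

variable {k A B : Type u} [Field k] [CommRing A] [HopfAlgebra k A] [CommRing B] [HopfAlgebra k B]
variable {π : A →ₐc[k] B}

theorem exists_comp_eq_of_ker_le {V W P : Type*} [AddCommGroup V] [Module k V] [AddCommGroup W]
    [Module k W] [AddCommGroup P] [Module k P] {f : V →ₗ[k] W} {g : V →ₗ[k] P}
    (h : LinearMap.ker f ≤ LinearMap.ker g) : ∃ t : W →ₗ[k] P, t ∘ₗ f = g := by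
  obtain ⟨i, hi⟩ := f.rangeRestrict.exists_rightInverse_of_surjective f.range_rangeRestrict
  obtain ⟨t, ht⟩ := LinearMap.exists_extend (g ∘ₗ i)
  refine ⟨t, LinearMap.ext fun v => ?_⟩
  have hv : i (f.rangeRestrict v) - v ∈ LinearMap.ker g := h <| by
    rw [LinearMap.mem_ker, map_sub, sub_eq_zero]
    exact congrArg Subtype.val (LinearMap.congr_fun hi (f.rangeRestrict v))
  rw [LinearMap.mem_ker, map_sub, sub_eq_zero] at hv
  exact (LinearMap.congr_fun ht (f.rangeRestrict v)).trans hv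

/-- The ideal of `k[G]^H` consisting of the values at `1` of the endomorphisms of the `H`-module
`k[G]` which vanish on `W`. -/
def valueIdeal (π : A →ₐc[k] B) (W : Submodule k A) : Ideal (invariantSubalgebra π) where
  carrier := {c | ∃ s : A →ₗ[k] A, (∀ x a, s ((coordinateAction π).act x a) =
    (coordinateAction π).act x (s a)) ∧ W ≤ LinearMap.ker s ∧ s 1 = c}
  zero_mem' := ⟨0, by simp, by simp, rfl⟩
  add_mem' := by
    rintro c d ⟨s, hs, hsW, hsc⟩ ⟨t, ht, htW, htd⟩
    refine ⟨s + t, fun x a => by simp [hs, ht], fun w hw => ?_, by simp [hsc, htd]⟩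
    rw [LinearMap.mem_ker, LinearMap.add_apply, hsW hw, htW hw, add_zero]
  smul_mem' := by
    rintro c d ⟨s, hs, hsW, hsd⟩
    refine ⟨LinearMap.mulLeft k (c : A) ∘ₗ s, fun x a => ?_, fun w hw => ?_, by simp [hsd]⟩
    · rw [LinearMap.comp_apply, LinearMap.comp_apply, LinearMap.mulLeft_apply,
        LinearMap.mulLeft_apply, coordinateAction_act_mul, hs, c.2 x]
    · rw [LinearMap.mem_ker, LinearMap.comp_apply, hsW hw, map_zero]

variable [IsAlgClosed k] [Algebra.FiniteType k A] [IsReduced A]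
variable {W : Submodule k A}

theorem apply_mul_inclusion_eq {ι : Type*} [Fintype ι] {g : ι → Points k A} {g₀ : Points k A}
    {v : ι → A} {c : A} (hW : ∀ x, ∀ w ∈ W, (coordinateAction π).act x w ∈ W)
    (hc : c ∈ invariantSubalgebra π)
    (hv : ∀ w ∈ W, ∑ j, v j * leftTranslation (g j) w = c * leftTranslation g₀ w)
    {x : Points k A} (hx : Function.Surjective (evalOn W fun j => g j * x)) (y : Points k B)
    (j : ι) : (x * inclusion π y) (v j) = x (v j) := by
  classical
  obtain ⟨w, hw⟩ := hx (Pi.single j 1)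
  have hval (i : ι) : (g i * x) (w : A) = Pi.single (M := fun _ => k) j 1 i := congrFun hw i
  have hact (z : Points k A) : (z * (x * inclusion π y)) ((coordinateAction π).act y⁻¹ w) =
      (z * x) (w : A) := by
    rw [← mul_assoc, ← apply_coordinateAction_act, RationalAction.act_act_inv]
  have h₁ := congrArg x (hv w w.2)
  have h₂ := congrArg (x * inclusion π y) (hv _ (hW y⁻¹ w w.2))
  simp only [map_sum, map_mul, apply_leftTranslation, hact, hval, Pi.single_apply, mul_ite,
    mul_one, mul_zero, Finset.sum_ite_eq', Finset.mem_univ, if_true] at h₁ h₂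
  rw [h₁, h₂, (mem_invariantSubalgebra_iff π).1 hc]

namespace IsRegularIso

variable {C : Type u} [CommRing C] [Algebra k C] {e : HomogeneousSpace π ≃ₜ Points k C}

theorem exists_invariant_sum_mul_leftTranslation_eq (he : IsRegularIso e)
    [FiniteDimensional k W] (hW : ∀ x, ∀ w ∈ W, (coordinateAction π).act x w ∈ W)
    {g : Fin (Module.finrank k W) → Points k A} (hg : Function.Bijective (evalOn W g))
    (g₀ : Points k A) :
    ∃ c ∈ invariantSubalgebra π, ∃ v : Fin (Module.finrank k W) → A,
      (1 : Points k A) c ≠ 0 ∧ (∀ j, v j ∈ invariantSubalgebra π) ∧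
      ∀ w ∈ W, ∑ j, v j * leftTranslation (g j) w = c * leftTranslation g₀ w := by
  obtain ⟨d, p, hd, hp⟩ := exists_sum_mul_leftTranslation_eq W g g₀
  have hstable (x : Points k A) (hx : x d ≠ 0) (h : Points k B) : (x * inclusion π h) d ≠ 0 := by
    simpa only [hd, mul_assoc] using evalOn_mul_inclusion_bijective hW ((hd x).1 hx) h
  obtain ⟨c, hc, hc₁, hcd⟩ := he.exists_ne_zero_subset (Points.isOpen_ne_zero d) hstable
    (x := 1) ((hd 1).2 (by simpa only [mul_one] using hg))
  obtain ⟨n, hn⟩ : c ∈ (Ideal.span {d}).radical :=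
    Points.mem_radical_of_forall (k := k) fun x hx => by_contra fun hxc =>
      hcd x hxc (hx d (Ideal.mem_span_singleton_self d))
  obtain ⟨r, hr⟩ := Ideal.mem_span_singleton'.1 hn
  have hc' := pow_mem hc (n + 1)
  have hv (w : A) (hw : w ∈ W) :
      ∑ j, c * r * p j * leftTranslation (g j) w = c ^ (n + 1) * leftTranslation g₀ w := by
    simp only [mul_assoc, ← Finset.mul_sum, hp w hw]
    rw [← mul_assoc r, hr, ← mul_assoc, pow_succ']
  refine ⟨c ^ (n + 1), hc', fun j => c * r * p j, by rw [map_pow]; exact pow_ne_zero _ hc₁,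
    fun j => (mem_invariantSubalgebra_iff π).2 fun x h => ?_, hv⟩
  by_cases hx : x c = 0
  · simp only [map_mul, hx, (mem_invariantSubalgebra_iff π).1 hc x h, zero_mul]
  · exact apply_mul_inclusion_eq hW hc' hv ((hd x).1 (hcd x hx)).surjective h j

theorem exists_mem_valueIdeal (he : IsRegularIso e) [FiniteDimensional k W]
    (hW : ∀ x, ∀ w ∈ W, (coordinateAction π).act x w ∈ W) (h₁ : 1 ∉ W) :
    ∃ c ∈ valueIdeal π W, (1 : Points k A) (c : A) ≠ 0 := by
  obtain ⟨g, hg⟩ := exists_evalOn_bijective W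
  obtain ⟨a, ha⟩ := hg.surjective 1
  have hga (j) : g j (a : A) = 1 := congrFun ha j
  obtain ⟨g₀, hg₀⟩ : ∃ g₀ : Points k A, g₀ (1 - a : A) ≠ 0 := by
    by_contra! h
    have h₁a : 1 - (a : A) = 0 :=
      Points.eq_of_forall_apply (k := k) fun x => (h x).trans (map_zero x.ofConv).symm
    exact h₁ (sub_eq_zero.1 h₁a ▸ a.2)
  obtain ⟨c, hc, v, hc₁, hv, hcv⟩ := he.exists_invariant_sum_mul_leftTranslation_eq hW hg g₀
  let s : A →ₗ[k] A := LinearMap.mulLeft k c ∘ₗ (leftTranslation g₀).toLinearMap -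
    ∑ j, LinearMap.mulLeft k (v j) ∘ₗ (leftTranslation (g j)).toLinearMap
  have hs (b : A) : s b = c * leftTranslation g₀ b - ∑ j, v j * leftTranslation (g j) b := by
    simp [s]
  have hsW : W ≤ LinearMap.ker s := fun w hw => by rw [LinearMap.mem_ker, hs, hcv w hw, sub_self]
  have hact (x : Points k B) (b : A) : s ((coordinateAction π).act x b) =
      (coordinateAction π).act x (s b) := by
    simp only [hs, map_sub, map_sum, coordinateAction_act_mul, coordinateAction_act_leftTranslation,
      hc x, fun j => hv j x]
  have hs₁ : s 1 ∈ invariantSubalgebra π := fun x => by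
    rw [← hact, coordinateAction_act_one]
  have hs₁a : s 1 = s (1 - a) := by
    rw [map_sub, LinearMap.mem_ker.1 (hsW a.2), sub_zero]
  refine ⟨⟨s 1, hs₁⟩, ⟨s, hact, hsW, rfl⟩, ?_⟩
  have hval : (1 : Points k A) (s 1) = (1 : Points k A) c * g₀ (1 - a : A) := by
    rw [hs₁a, hs]
    simp only [map_sub, map_sum, map_mul, map_one, apply_leftTranslation, mul_one, hga, sub_self,
      mul_zero, Finset.sum_const_zero, sub_zero]
  rw [hval]
  exact mul_ne_zero hc₁ hg₀

theorem one_mem_valueIdeal (he : IsRegularIso e) [Algebra.FiniteType k C] [FiniteDimensional k W]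
    (hW : ∀ x, ∀ w ∈ W, (coordinateAction π).act x w ∈ W) (h₁ : 1 ∉ W) :
    1 ∈ valueIdeal π W := by
  refine (Ideal.eq_top_iff_one _).1 (he.ideal_eq_top fun x => ?_)
  obtain ⟨c, ⟨s, hs, hsW, hsc⟩, hc⟩ := he.exists_mem_valueIdeal hW h₁
  let t : A →ₗ[k] A := (leftTranslation x⁻¹).toLinearMap ∘ₗ s
  have ht (y : Points k B) (a : A) :
      t ((coordinateAction π).act y a) = (coordinateAction π).act y (t a) := by
    simp only [t, LinearMap.comp_apply, hs, AlgHom.toLinearMap_apply,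
      coordinateAction_act_leftTranslation]
  have ht₁ : t 1 ∈ invariantSubalgebra π := fun y => by rw [← ht, coordinateAction_act_one]
  refine ⟨⟨t 1, ht₁⟩, ⟨t, ht, hsW.trans (LinearMap.ker_le_ker_comp _ _), rfl⟩, ?_⟩
  change x (leftTranslation x⁻¹ (s 1)) ≠ 0
  rwa [apply_leftTranslation, inv_mul_cancel, hsc]

end IsRegularIso

theorem IsAffineHomogeneousSpace.hasLocalIntegrals (hπ : Function.Surjective π)
    (h : IsAffineHomogeneousSpace π) : HasLocalIntegrals π := by
  obtain ⟨C, _, _, _, _, e, he⟩ := h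
  have : Nontrivial B := (Bialgebra.counitAlgHom k B).toRingHom.domain_nontrivial
  intro S hS
  choose l hl using hπ
  let ρ := coordinateAction π
  let V := ρ.stableSpan (insert 1 (l '' S))
  have hlV := ρ.subset_stableSpan (insert 1 (l '' S))
  have := ρ.finiteDimensional_stableSpan ((hS.image l).insert 1)
  let W := V.toSubmodule ⊓ LinearMap.ker (π : A →ₗ[k] B)
  have : FiniteDimensional k W := Submodule.finiteDimensional_of_le inf_le_left
  have hW (x : Points k B) (w : A) (hw : w ∈ W) : ρ.act x w ∈ W :=
    ⟨V.apply_mem_toSubmodule x hw.1,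
      (map_coordinateAction_act π x w).trans (by rw [show π w = 0 from hw.2, map_zero])⟩
  have h₁ : 1 ∉ W := fun h₁ => one_ne_zero ((map_one π).symm.trans h₁.2)
  obtain ⟨s, hs, hsW, hs₁⟩ := IsRegularIso.one_mem_valueIdeal he hW h₁
  obtain ⟨σ, hσ⟩ := exists_comp_eq_of_ker_le
    (f := (π : A →ₗ[k] B) ∘ₗ V.toSubmodule.subtype) (g := s ∘ₗ V.toSubmodule.subtype)
    fun v hv => hsW ⟨v.2, hv⟩
  have hσπ (v : A) (hv : v ∈ V) : σ (π v) = s v := LinearMap.congr_fun hσ ⟨v, hv⟩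
  refine ⟨σ, by rw [← map_one π, hσπ 1 (hlV (Set.mem_insert _ _)), hs₁]; rfl, fun b hb x => ?_⟩
  have hbV : l b ∈ V := hlV (Set.mem_insert_of_mem _ ⟨b, hb, rfl⟩)
  rw [← hl b, ← map_coordinateAction_act]
  exact (hσπ _ (V.apply_mem_toSubmodule x hbV)).trans ((hs x _).trans (by rw [hσπ _ hbV]))

end Intertwining

/-! ### Finite generation of a localization of a subalgebra -/

section FiniteGeneration

variable {k R A : Type u} [Field k] [CommRing R] [CommRing A] [Algebra R A]

theorem exists_isIntegral_away [IsDomain R] [Algebra.FiniteType R A] {L : Type*} [CommRing L]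
    [Algebra R L] [Algebra.IsAlgebraic R L] (φ : A →ₐ[R] L) :
    ∃ f : R, f ≠ 0 ∧ ∀ (S : Type u) [CommRing S] [Algebra R S] [IsLocalization.Away f S]
      [Algebra S L] [IsScalarTower R S L] (a : A), IsIntegral S (φ a) := by
  obtain ⟨t, ht⟩ := Algebra.FiniteType.out (R := R) (A := A)
  choose m hm₀ hm using fun a =>
    (Algebra.IsAlgebraic.isAlgebraic (R := R) (φ a)).exists_integral_multiple
  refine ⟨∏ a ∈ t, m a, Finset.prod_ne_zero_iff.2 fun a _ => hm₀ a, fun S _ _ _ _ _ a => ?_⟩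
  let I : Subalgebra R A := ((integralClosure S L).restrictScalars R).comap φ
  suffices h : I = ⊤ from (h ▸ Algebra.mem_top : a ∈ I)
  rw [eq_top_iff, ← ht, Algebra.adjoin_le_iff]
  intro a ha
  have hunit : IsUnit (algebraMap R S (m a)) :=
    IsLocalization.Away.isUnit_of_dvd (∏ a ∈ t, m a) (Finset.dvd_prod_of_mem m ha)
  have : IsIntegral S (algebraMap R S (m a) • φ a) := by
    rw [algebraMap_smul]
    exact (hm a).tower_top
  have := this.smul (↑hunit.unit⁻¹ : S)
  rwa [smul_smul, IsUnit.val_inv_mul, one_smul] at this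

theorem nontrivial_fractionRing_tensorProduct [IsDomain R]
    (h : Function.Injective (algebraMap R A)) : Nontrivial (FractionRing R ⊗[R] A) :=
  (Module.Flat.lTensor_preserves_injective_linearMap (M := FractionRing R)
    (Algebra.linearMap R A) h).nontrivial (α := FractionRing R ⊗[R] R)

variable [Algebra k R] [Algebra k A] [IsScalarTower k R A]

theorem finiteType_tensorProduct {S : Type u} [CommRing S] [Algebra R S] [Algebra k S]
    [IsScalarTower k R S] [Algebra.FiniteType k A] [Algebra.FiniteType R S] :
    Algebra.FiniteType k (S ⊗[R] A) :=
  have : Algebra.FiniteType k (A ⊗[R] S) := .trans (S := A) inferInstance inferInstance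
  .equiv this ((Algebra.TensorProduct.comm R A S).restrictScalars k)

theorem finiteType_of_forall_isIntegral {S L : Type u} [CommRing S] [Algebra R S] [Algebra k S]
    [IsScalarTower k R S] [CommRing L] [Algebra R L] [Algebra S L] [IsScalarTower R S L]
    [Algebra k L] [IsScalarTower k S L] [Algebra.FiniteType k A] [Algebra.FiniteType R S]
    (h : Function.Injective (algebraMap S L)) (φ : A →ₐ[R] L) (hφ : ∀ a, IsIntegral S (φ a)) :
    Algebra.FiniteType k S := by
  let ψ : S ⊗[R] A →ₐ[S] L := Algebra.TensorProduct.lift (Algebra.ofId S L) φ fun _ _ => .all _ _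
  have hψ : ∀ c, IsIntegral S (ψ c) := fun c => by
    induction c with
    | zero => simpa using isIntegral_zero
    | tmul s a => simpa [ψ] using isIntegral_algebraMap.mul (hφ a)
    | add c d hc hd => simpa using hc.add hd
  have : Algebra.FiniteType k (S ⊗[R] A) := finiteType_tensorProduct
  have hT : Algebra.FiniteType k ψ.range := .of_surjective (ψ.rangeRestrict.restrictScalars k)
    ψ.rangeRestrict_surjective
  have : Algebra.FiniteType S ψ.range := .of_restrictScalars_finiteType k S ψ.range
  have : Algebra.IsIntegral S ψ.range :=
    ⟨fun ⟨_, c, hc⟩ => (isIntegral_algHom_iff ψ.range.val Subtype.val_injective).1 (hc ▸ hψ c)⟩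
  have : Module.Finite S ψ.range := Algebra.IsIntegral.finite
  exact ⟨fg_of_fg_of_fg k S ψ.range hT.out Module.Finite.fg_top fun s t hst =>
    h (congrArg Subtype.val hst)⟩

theorem exists_finiteType_localization_away_of_isDomain [IsDomain R] [Algebra.FiniteType k A]
    (h : Function.Injective (algebraMap R A)) :
    ∃ f : R, f ≠ 0 ∧ Algebra.FiniteType k (Localization.Away f) := by
  have := Algebra.FiniteType.of_restrictScalars_finiteType k R A
  have := nontrivial_fractionRing_tensorProduct h
  obtain ⟨m, hm⟩ := Ideal.exists_maximal (FractionRing R ⊗[R] A)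
  let L := (FractionRing R ⊗[R] A) ⧸ m
  let _ : Field L := Ideal.Quotient.field m
  have : Module.Finite (FractionRing R) L :=
    finite_of_finite_type_of_isJacobsonRing (FractionRing R) L
  have : Algebra.IsAlgebraic (FractionRing R) L := Algebra.IsAlgebraic.of_finite _ _
  have : Algebra.IsAlgebraic R L :=
    (IsFractionRing.comap_isAlgebraic_iff (K := FractionRing R)).2 inferInstance
  let φ : A →ₐ[R] L := (Ideal.Quotient.mkₐ R m).comp Algebra.TensorProduct.includeRight
  obtain ⟨f, hf, hφ⟩ := exists_isIntegral_away φ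
  have hRL : Function.Injective (algebraMap R L) := by
    rw [IsScalarTower.algebraMap_eq R (FractionRing R) L]
    exact (algebraMap (FractionRing R) L).injective.comp (IsFractionRing.injective R _)
  let S := Localization.Away f
  have hfL : IsUnit (algebraMap R L f) := isUnit_iff_ne_zero.2 ((map_ne_zero_iff _ hRL).2 hf)
  let _ : Algebra S L := (IsLocalization.Away.lift f hfL).toAlgebra
  have : IsScalarTower R S L :=
    .of_algebraMap_eq fun r => (IsLocalization.Away.lift_eq f hfL r).symm
  have : IsScalarTower k S L := .to₁₃₄ k R S L
  have : Algebra.FiniteType R S := IsLocalization.finiteType_of_monoid_fg (.powers f) S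
  have hSL : Function.Injective (algebraMap S L) :=
    (IsLocalization.lift_injective_iff _).2 fun r s =>
      ⟨fun hrs => by simp only [IsScalarTower.algebraMap_apply R S L, hrs],
        fun hrs => congrArg _ (hRL hrs)⟩
  exact ⟨f, hf, finiteType_of_forall_isIntegral hSL φ (hφ S)⟩

omit [Algebra k R] [Algebra k A] [IsScalarTower k R A] in
theorem finite_minimalPrimes_of_injective [IsNoetherianRing A]
    (h : Function.Injective (algebraMap R A)) : (minimalPrimes R).Finite := by
  refine ((minimalPrimes.finite_of_isNoetherianRing A).image
    (Ideal.comap (algebraMap R A))).subset fun q hq => ?_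
  refine Ideal.exists_minimalPrimes_comap_eq (algebraMap R A) q ?_
  rwa [← RingHom.ker_eq_comap_bot, (RingHom.injective_iff_ker_eq_bot _).1 h]

theorem exists_notMem_forall_mul_eq_zero [IsReduced R] (hfin : (minimalPrimes R).Finite)
    {q : Ideal R} (hq : q ∈ minimalPrimes R) : ∃ g ∉ q, ∀ z ∈ q, g * z = 0 := by
  classical
  have hqp : q.IsPrime := hq.1.1
  obtain ⟨g, hg, hgq⟩ : ∃ g ∈ (hfin.toFinset.erase q).inf id, g ∉ q := by
    refine SetLike.not_le_iff_exists.1 fun hle => ?_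
    obtain ⟨p, hp, hpq⟩ := (hqp.inf_le').1 hle
    rw [Finset.mem_erase, Set.Finite.mem_toFinset] at hp
    exact hp.1 (hpq.antisymm (hq.2 hp.2.1 hpq))
  refine ⟨g, hgq, fun z hz => ?_⟩
  have hgz : g * z ∈ sInf (minimalPrimes R) := Ideal.mem_sInf.2 fun {p} hp => by
    rcases eq_or_ne p q with rfl | hne
    · exact p.mul_mem_left _ hz
    · exact p.mul_mem_right _ (Finset.inf_le (f := id)
        (Finset.mem_erase.2 ⟨hne, hfin.mem_toFinset.2 hp⟩) hg)
  rw [minimalPrimes, Ideal.sInf_minimalPrimes] at hgz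
  exact (show IsNilpotent (g * z) from hgz).eq_zero

theorem isDomain_localization_away {q : Ideal R} [hq : q.IsPrime] {g : R} (hg : g ∉ q)
    (hgq : ∀ z ∈ q, g * z = 0) : IsDomain (Localization.Away g) := by
  have hzero : ∀ (z : R) (s : Submonoid.powers g),
      IsLocalization.mk' (Localization.Away g) z s = 0 ↔ z ∈ q := fun z s => by
    rw [IsLocalization.mk'_eq_zero_iff]
    refine ⟨?_, fun hz => ⟨⟨g, 1, pow_one g⟩, hgq z hz⟩⟩
    rintro ⟨⟨_, n, rfl⟩, hn⟩
    exact (hq.mem_or_mem (hn ▸ q.zero_mem)).resolve_left fun h => hg (hq.mem_of_pow_mem n h)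
  have : Nontrivial (Localization.Away g) := ⟨1, 0, fun h =>
    hq.one_notMem ((hzero 1 1).1 (by rwa [IsLocalization.mk'_one, map_one]))⟩
  have : NoZeroDivisors (Localization.Away g) := ⟨fun {a b} hab => by
    obtain ⟨a, s, rfl⟩ := IsLocalization.exists_mk'_eq (.powers g) a
    obtain ⟨b, t, rfl⟩ := IsLocalization.exists_mk'_eq (.powers g) b
    rw [← IsLocalization.mk'_mul, hzero] at hab
    simpa only [hzero] using hq.mem_or_mem hab⟩
  exact NoZeroDivisors.to_isDomain _

omit [Algebra k R] in
theorem exists_isLocalization_away (g : R) {s : Localization.Away g} (hs : s ≠ 0) :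
    ∃ f : R, f ≠ 0 ∧ IsLocalization.Away f (Localization.Away s) := by
  obtain ⟨n, f, hf⟩ := IsLocalization.Away.surj (S := Localization.Away g) g s
  have hg : IsUnit (algebraMap R (Localization.Away g) g) :=
    IsLocalization.Away.algebraMap_isUnit g
  have : IsLocalization.Away (algebraMap R (Localization.Away g) f) (Localization.Away s) :=
    .of_associated (hf ▸ associated_mul_unit_right s _ (hg.pow n))
  refine ⟨g * f, fun h => hs ?_, .mul' (Localization.Away g) _ g f⟩
  rw [← (hg.pow n).mul_left_eq_zero, hf, ← hg.mul_right_eq_zero, ← map_mul, h, map_zero]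

theorem exists_finiteType_localization_away [Nontrivial R] [IsReduced R] [Algebra.FiniteType k A]
    (h : Function.Injective (algebraMap R A)) :
    ∃ f : R, f ≠ 0 ∧ Algebra.FiniteType k (Localization.Away f) := by
  have : IsNoetherianRing A := Algebra.FiniteType.isNoetherianRing k A
  obtain ⟨q, hq⟩ := Ideal.nonempty_minimalPrimes (bot_ne_top (α := Ideal R))
  have hqp : q.IsPrime := hq.1.1
  obtain ⟨g, hg, hgq⟩ := exists_notMem_forall_mul_eq_zero (finite_minimalPrimes_of_injective h) hq
  let Rg := Localization.Away g
  let Ag := Localization.Away (algebraMap R A g)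
  have : IsDomain Rg := isDomain_localization_away hg hgq
  let _ : Algebra Rg Ag := (IsLocalization.Away.map Rg Ag (algebraMap R A) g).toAlgebra
  have : IsScalarTower R Rg Ag := .of_algebraMap_eq fun r => by
    simp only [RingHom.algebraMap_toAlgebra, IsLocalization.Away.map, IsLocalization.map_eq,
      IsScalarTower.algebraMap_apply R A Ag]
  have : IsScalarTower k Rg Ag := .to₁₃₄ k R Rg Ag
  have hinj : Function.Injective (algebraMap Rg Ag) :=
    (IsLocalization.Away.map_injective_iff Ag (algebraMap R A) g).2 fun a ha =>
      ⟨0, by rw [(map_eq_zero_iff _ h).1 ha, mul_zero]⟩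
  have : Algebra.FiniteType A Ag :=
    IsLocalization.finiteType_of_monoid_fg (.powers (algebraMap R A g)) Ag
  have : Algebra.FiniteType k Ag := .trans (S := A) inferInstance inferInstance
  obtain ⟨f', hf', hfin⟩ := exists_finiteType_localization_away_of_isDomain (k := k) hinj
  obtain ⟨f, hf, hff'⟩ := exists_isLocalization_away g hf'
  exact ⟨f, hf, .equiv hfin ((IsLocalization.algEquiv (.powers f) (Localization.Away f')
    (Localization.Away f)).restrictScalars k)⟩

end FiniteGeneration

/-! ### A total integral makes the homogeneous space affine -/

section Retraction

variable {k A B : Type u} [Field k] [CommRing A] [HopfAlgebra k A] [CommRing B] [HopfAlgebra k B]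

/-- The algebra `k[G]` as a `(k[G], H)`-module. -/
def coordinateModule (π : A →ₐc[k] B) : EquivariantModule π where
  carrier := A
  action := coordinateAction π
  act_smul := coordinateAction_act_mul π

variable {π : A →ₐc[k] B}

/-- Multiplication by an invariant function, as an endomorphism of a `(k[G], H)`-module. -/
def EquivariantModule.lsmulHom (M : EquivariantModule π) (c : invariantSubalgebra π) :
    M.Hom M where
  toLinearMap := LinearMap.lsmul A M.carrier c
  map_act x m := by rw [LinearMap.lsmul_apply, LinearMap.lsmul_apply, M.act_smul, c.2 x]

variable [IsAlgClosed k] [Algebra.FiniteType k B] [IsReduced B] {σ : B →ₗ[k] A}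

theorem IsTotalIntegral.average_mem_invariants (hσ : IsTotalIntegral π σ)
    (M : EquivariantModule π) (m : M.carrier) : M.average σ m ∈ M.invariants := by
  obtain ⟨t, ht⟩ := TensorProduct.exists_finset (M.action.coactInv m)
  exact M.average_mem_invariants ht fun p _ x => hσ.map_act x p.2

/-- The projection of `k[G]` onto the algebra of invariants given by a total integral. -/
def IsTotalIntegral.retraction (hσ : IsTotalIntegral π σ) :
    A →ₗ[invariantSubalgebra π] invariantSubalgebra π where
  toFun a := ⟨(coordinateModule π).average σ a, hσ.average_mem_invariants (coordinateModule π) a⟩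
  map_add' a b := Subtype.ext (map_add ((coordinateModule π).average σ) a b)
  map_smul' c a :=
    Subtype.ext (((coordinateModule π).lsmulHom c).map_average σ (a : A)).symm

theorem IsTotalIntegral.retraction_one (hσ : IsTotalIntegral π σ) : hσ.retraction 1 = 1 :=
  Subtype.ext ((coordinateModule π).average_of_mem_invariants hσ.map_one
    (m := (1 : A)) (coordinateAction_act_one π))

theorem IsTotalIntegral.retraction_apply_eq_zero (hσ : IsTotalIntegral π σ) {x : Points k A}
    {a : A} (h : ∀ y : Points k B, (x * inclusion π y) a = 0) :
    x (hσ.retraction a : A) = 0 := by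
  have hx (t : A ⊗[k] B) : x (smulVia σ A t) =
      x (σ (TensorProduct.lid k B (x.ofConv.toLinearMap.rTensor B t))) := by
    induction t with
    | zero => simp
    | tmul v c => simp [mul_comm]
    | add s t hs ht => simp only [map_add, hs, ht]
  have ha : x.ofConv.toLinearMap.rTensor B ((coordinateAction π).coactInv a) = 0 :=
    eq_of_forall_evalRight fun y => by
      rw [evalRight_rTensor, RationalAction.evalRight_coactInv, map_zero]
      exact (apply_coordinateAction_act π y⁻¹ x a).trans (h y⁻¹)
  refine (hx ((coordinateAction π).coactInv a)).trans ?_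
  rw [ha, map_zero, map_zero, map_zero]

theorem apply_mem_of_mem_map {S T : Type*} [CommRing S] [CommRing T] [Algebra S T]
    (p : T →ₗ[S] S) {I : Ideal S} {a : T} (ha : a ∈ I.map (algebraMap S T)) : p a ∈ I := by
  have ha' : a ∈ I • (⊤ : Submodule S T) := by rwa [Ideal.smul_top_eq_map]
  refine Submodule.smul_induction_on ha' (fun r hr t _ => ?_) fun s t hs ht => ?_
  · rw [map_smul]
    exact I.mul_mem_right _ hr
  · rw [map_add]
    exact I.add_mem hs ht

theorem eq_top_of_map_algebraMap_eq_top {S T : Type*} [CommRing S] [CommRing T] [Algebra S T]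
    {p : T →ₗ[S] S} (hp : p 1 = 1) {I : Ideal S} (hI : I.map (algebraMap S T) = ⊤) : I = ⊤ :=
  (Ideal.eq_top_iff_one I).2 (hp ▸ apply_mem_of_mem_map p (hI ▸ Submodule.mem_top))

theorem IsTotalIntegral.ideal_eq_top [Algebra.FiniteType k A] (hσ : IsTotalIntegral π σ)
    {I : Ideal (invariantSubalgebra π)} (hI : ∀ x : Points k A, ∃ c ∈ I, x (c : A) ≠ 0) :
    I = ⊤ :=
  eq_top_of_map_algebraMap_eq_top hσ.retraction_one <| Points.ideal_eq_top (k := k) fun x =>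
    let ⟨c, hc, hxc⟩ := hI x
    ⟨c, Ideal.mem_map_of_mem _ hc, hxc⟩

end Retraction

section Separation

variable {k A B : Type u} [Field k] [CommRing A] [HopfAlgebra k A] [CommRing B] [HopfAlgebra k B]
variable {π : A →ₐc[k] B}

theorem mem_subgroup_iff (hπ : Function.Surjective π) {x : Points k A} :
    x ∈ subgroup π ↔ ∀ a, π a = 0 → x a = 0 := by
  refine ⟨?_, fun h => ?_⟩
  · rintro ⟨y, rfl⟩ a ha
    rw [inclusion_apply, ha, map_zero]
  · let y : B →ₐ[k] k := AlgHom.liftOfSurjective (π : A →ₐ[k] B) hπ x.ofConv h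
    exact ⟨WithConv.toConv y, WithConv.ofConv_injective (AlgHom.ext fun a =>
      AlgHom.liftOfSurjective_apply (π : A →ₐ[k] B) hπ x.ofConv h a)⟩

theorem isClosed_singleton_coset (hπ : Function.Surjective π) (q : HomogeneousSpace π) :
    IsClosed {q} := by
  obtain ⟨x, rfl⟩ := QuotientGroup.mk_surjective q
  refine ⟨isOpen_coinduced.2 (isOpen_iff_forall_mem_open.2 fun y hy => ?_)⟩
  obtain ⟨a, ha, hya⟩ : ∃ a, π a = 0 ∧ (x⁻¹ * y) a ≠ 0 := by
    have : x⁻¹ * y ∉ subgroup π := fun h => hy (QuotientGroup.eq.2 h).symm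
    rw [mem_subgroup_iff hπ] at this
    push Not at this
    exact this
  refine ⟨{z | z (leftTranslation x⁻¹ a) ≠ 0}, fun z hz hzx => hz ?_, Points.isOpen_ne_zero _, ?_⟩
  · rw [apply_leftTranslation]
    exact (mem_subgroup_iff hπ).1 (QuotientGroup.eq.1 hzx.symm) a ha
  · rwa [Set.mem_ofPred_eq, apply_leftTranslation]

variable [IsAlgClosed k] [Algebra.FiniteType k A] [Algebra.FiniteType k B] [IsReduced B]
variable {σ : B →ₗ[k] A}

theorem IsTotalIntegral.exists_invariant_eq_zero_eq_one (hσ : IsTotalIntegral π σ)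
    {S T : Set (HomogeneousSpace π)} (hS : IsClosed S) (hT : IsClosed T) (hST : Disjoint S T) :
    ∃ c : invariantSubalgebra π, (∀ x : Points k A, (x : HomogeneousSpace π) ∈ S → x (c : A) = 0) ∧
      ∀ x : Points k A, (x : HomogeneousSpace π) ∈ T → x (c : A) = 1 := by
  let p : Points k A → HomogeneousSpace π := (↑)
  have hp : Continuous p := continuous_quot_mk
  have hpH : ∀ x y, p (x * inclusion π y) = p x := coe_mul_inclusion π
  have htop := Points.sup_vanishingIdeal_eq_top (hS.preimage hp) (hT.preimage hp)
    (hST.preimage p)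
  obtain ⟨i, hi, j, hj, hij⟩ := Submodule.mem_sup.1 ((Ideal.eq_top_iff_one _).1 htop)
  rw [Points.mem_vanishingIdeal] at hi hj
  refine ⟨hσ.retraction i, fun x hx => ?_, fun x hx => ?_⟩
  · refine hσ.retraction_apply_eq_zero fun y => hi _ ?_
    rwa [Set.mem_preimage, hpH]
  · have hxj : x (hσ.retraction j : A) = 0 := hσ.retraction_apply_eq_zero fun y => hj _ <| by
      rwa [Set.mem_preimage, hpH]
    calc x (hσ.retraction i : A) = x (hσ.retraction i : A) + x (hσ.retraction j : A) := by
          rw [hxj, add_zero]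
      _ = x (hσ.retraction (i + j) : A) := by rw [map_add, Subalgebra.coe_add, map_add]
      _ = 1 := by rw [hij, hσ.retraction_one]; exact _root_.map_one x.ofConv

end Separation

section InvariantsFiniteType

variable {k A B : Type u} [Field k] [CommRing A] [HopfAlgebra k A] [CommRing B] [HopfAlgebra k B]
variable {π : A →ₐc[k] B} {σ : B →ₗ[k] A}

/-- Left translation by `g`, restricted to the algebra `k[G]^H`. -/
def invariantTranslation (π : A →ₐc[k] B) (g : Points k A) :
    invariantSubalgebra π →ₐ[k] invariantSubalgebra π :=
  ((leftTranslation g).comp (invariantSubalgebra π).val).codRestrict _ fun c x => by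
    refine (coordinateAction_act_leftTranslation π x g c).trans ?_
    rw [c.2 x]
    rfl

theorem apply_invariantTranslation (g x : Points k A) (c : invariantSubalgebra π) :
    x (invariantTranslation π g c : A) = (g * x) (c : A) :=
  apply_leftTranslation g x c

variable [IsAlgClosed k] [Algebra.FiniteType k A] [IsReduced A]

theorem invariantTranslation_surjective (g : Points k A) :
    Function.Surjective (invariantTranslation π g) :=
  fun c => ⟨invariantTranslation π g⁻¹ c, Subtype.ext <| Points.eq_of_forall_apply (k := k)
    fun x => by rw [apply_invariantTranslation, apply_invariantTranslation, inv_mul_cancel_left]⟩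

variable [Algebra.FiniteType k B] [IsReduced B]

/- By generic finiteness a localization `k[G]^H_f` is finitely generated, and the translates of `f`
have no common zero. -/
theorem IsTotalIntegral.finiteType_invariantSubalgebra (hσ : IsTotalIntegral π σ) :
    Algebra.FiniteType k (invariantSubalgebra π) := by
  have : Nontrivial A := (Bialgebra.counitAlgHom k A).toRingHom.domain_nontrivial
  have : IsReduced (invariantSubalgebra π) :=
    isReduced_of_injective (invariantSubalgebra π).val Subtype.val_injective
  obtain ⟨f, hf, hfin⟩ := exists_finiteType_localization_away (k := k)
    (R := invariantSubalgebra π) (A := A) Subtype.val_injective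
  obtain ⟨x₀, hx₀⟩ : ∃ x : Points k A, x (f : A) ≠ 0 := by
    by_contra! h
    exact hf (Subtype.ext (Points.eq_of_forall_apply (k := k) fun x => by
      rw [h, ZeroMemClass.coe_zero, map_zero]))
  refine .of_span_eq_top_target (Set.range fun g => invariantTranslation π g f)
    (hσ.ideal_eq_top fun x => ⟨_, Ideal.subset_span ⟨x₀ * x⁻¹, rfl⟩, ?_⟩) ?_
  · rwa [apply_invariantTranslation, inv_mul_cancel_right]
  · rintro _ ⟨g, rfl⟩
    exact .of_surjective _ (IsLocalization.Away.mapₐ_surjective_of_surjective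
      (Aₚ := Localization.Away f) (Bₚ := Localization.Away (invariantTranslation π g f)) f
      (invariantTranslation_surjective g))

end InvariantsFiniteType

section QuotientMap

variable {k C D : Type u} [Field k] [CommRing C] [Algebra k C] [CommRing D] [Algebra k D]

/-- The morphism of affine varieties with comorphism `φ`. -/
def Points.comap (φ : C →ₐ[k] D) (x : Points k D) : Points k C :=
  WithConv.toConv (x.ofConv.comp φ)

theorem Points.continuous_comap (φ : C →ₐ[k] D) : Continuous (Points.comap φ) :=
  continuous_induced_rng.2 <|
    (PrimeSpectrum.continuous_comap φ.toRingHom).comp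
      (continuous_induced_dom (f := Points.toPrimeSpectrum))

theorem IsRegularOn.comp_comap {U : Set (Points k C)} {f : Points k C → k} (hf : IsRegularOn U f)
    (φ : C →ₐ[k] D) : IsRegularOn (Points.comap φ ⁻¹' U) (f ∘ Points.comap φ) := by
  intro x hx
  obtain ⟨a, s, hs, has⟩ := hf _ hx
  exact ⟨φ a, φ s, hs, fun y hy hys => has _ hy hys⟩

variable {A B : Type u} [CommRing A] [HopfAlgebra k A] [CommRing B] [HopfAlgebra k B]
variable [IsAlgClosed k] [Algebra.FiniteType k A] [IsReduced A]

/-- The map from `G/H` to the affine variety with coordinate algebra `k[G]^H`. -/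
def quotientToPoints (π : A →ₐc[k] B) (q : HomogeneousSpace π) :
    Points k (invariantSubalgebra π) :=
  Quotient.lift (Points.comap (invariantSubalgebra π).val) (fun _ _ hxy =>
    WithConv.ofConv_injective (AlgHom.ext fun c =>
      apply_eq_of_coe_eq c.2 (Quotient.sound hxy))) q

theorem quotientToPoints_coe_apply (π : A →ₐc[k] B) (x : Points k A)
    (c : invariantSubalgebra π) : quotientToPoints π x c = x (c : A) := rfl

theorem continuous_quotientToPoints (π : A →ₐc[k] B) : Continuous (quotientToPoints π) :=
  (Points.continuous_comap (invariantSubalgebra π).val).quotient_lift _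

namespace IsTotalIntegral

variable [Algebra.FiniteType k B] [IsReduced B] {π : A →ₐc[k] B} {σ : B →ₗ[k] A}

theorem exists_eq_zero_ne_zero (hπ : Function.Surjective π) (hσ : IsTotalIntegral π σ)
    {S : Set (HomogeneousSpace π)} (hS : IsClosed S) {q : HomogeneousSpace π} (hq : q ∉ S) :
    ∃ c, (∀ p ∈ S, quotientToPoints π p c = 0) ∧ quotientToPoints π q c ≠ 0 := by
  obtain ⟨c, hc₀, hc₁⟩ := hσ.exists_invariant_eq_zero_eq_one hS (isClosed_singleton_coset hπ q)
    (Set.disjoint_singleton_right.2 hq)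
  refine ⟨c, fun p hp => ?_, ?_⟩
  · obtain ⟨x, rfl⟩ := QuotientGroup.mk_surjective p
    exact hc₀ x hp
  · obtain ⟨x, rfl⟩ := QuotientGroup.mk_surjective q
    exact ne_of_eq_of_ne (hc₁ x rfl) one_ne_zero

theorem quotientToPoints_injective (hπ : Function.Surjective π) (hσ : IsTotalIntegral π σ) :
    Function.Injective (quotientToPoints π) := by
  intro p q hpq
  by_contra hne
  obtain ⟨c, hc₀, hc⟩ := hσ.exists_eq_zero_ne_zero hπ (isClosed_singleton_coset hπ p) (Ne.symm hne)
  exact hc (hpq ▸ hc₀ p rfl)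

theorem quotientToPoints_surjective (hσ : IsTotalIntegral π σ) :
    Function.Surjective (quotientToPoints π) := by
  intro y
  by_contra! hy
  refine (RingHom.ker_isPrime y.ofConv).ne_top (hσ.ideal_eq_top fun x => ?_)
  obtain ⟨c, hc⟩ : ∃ c, quotientToPoints π x c ≠ y c := by
    by_contra! h
    exact hy x (WithConv.ofConv_injective (AlgHom.ext h))
  refine ⟨c - algebraMap k _ (y c), by simp [RingHom.mem_ker], ?_⟩
  rw [← quotientToPoints_coe_apply, map_sub, AlgHomClass.commutes]
  exact sub_ne_zero.2 hc

theorem isOpenMap_quotientToPoints (hπ : Function.Surjective π) (hσ : IsTotalIntegral π σ) :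
    IsOpenMap (quotientToPoints π) := by
  refine fun U hU => isOpen_iff_forall_mem_open.2 ?_
  rintro _ ⟨q, hq, rfl⟩
  obtain ⟨c, hc, hqc⟩ := hσ.exists_eq_zero_ne_zero hπ hU.isClosed_compl (Set.notMem_compl_iff.2 hq)
  refine ⟨{y | y c ≠ 0}, fun y hy => ?_, Points.isOpen_ne_zero c, hqc⟩
  obtain ⟨p, rfl⟩ := hσ.quotientToPoints_surjective y
  exact ⟨p, by_contra fun hp => hy (hc p hp), rfl⟩

/-- The homeomorphism of `G/H` with the affine variety with coordinate algebra `k[G]^H`. -/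
def quotientHomeomorph (hπ : Function.Surjective π) (hσ : IsTotalIntegral π σ) :
    HomogeneousSpace π ≃ₜ Points k (invariantSubalgebra π) :=
  (Equiv.ofBijective _
    ⟨hσ.quotientToPoints_injective hπ, hσ.quotientToPoints_surjective⟩).toHomeomorphOfContinuousOpen
    (continuous_quotientToPoints π) (hσ.isOpenMap_quotientToPoints hπ)

theorem isRegularIso_quotientHomeomorph (hπ : Function.Surjective π) (hσ : IsTotalIntegral π σ) :
    IsRegularIso (hσ.quotientHomeomorph hπ) := by
  refine fun U hU f => ⟨fun hf => hf.comp_comap _, fun hf y hy => ?_⟩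
  obtain ⟨c, hc, hcU⟩ := Points.exists_ne_zero_subset hU hy
  obtain ⟨n, a, ha⟩ := hf.exists_pow_mul_eq (c := (c : A)) fun x hx => hcU (quotientToPoints π x) hx
  have hac (x : Points k A) :
      x (a * c) = quotientToPoints π x c ^ (n + 1) * f (quotientToPoints π x) := by
    by_cases hx : quotientToPoints π x ∈ U
    · rw [map_mul, ← ha x hx, pow_succ, mul_right_comm]
      rfl
    · have hxc : quotientToPoints π x c = 0 := by_contra fun h => hx (hcU _ h)
      rw [map_mul, ← quotientToPoints_coe_apply, hxc, mul_zero, zero_pow n.succ_ne_zero, zero_mul]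
  have hinv : a * c ∈ invariantSubalgebra π := (mem_invariantSubalgebra_iff π).2 fun x h => by
    rw [hac, hac, coe_mul_inclusion]
  refine ⟨⟨a * c, hinv⟩, c ^ (n + 1), by simpa using hc, fun z _ hz => (eq_div_iff hz).2 ?_⟩
  obtain ⟨q, rfl⟩ := hσ.quotientToPoints_surjective z
  obtain ⟨x, rfl⟩ := QuotientGroup.mk_surjective q
  rw [map_pow, mul_comm]
  exact (hac x).symm

theorem isAffineHomogeneousSpace (hπ : Function.Surjective π) (hσ : IsTotalIntegral π σ) :
    IsAffineHomogeneousSpace π :=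
  ⟨invariantSubalgebra π, inferInstance, inferInstance, hσ.finiteType_invariantSubalgebra,
    isReduced_of_injective (invariantSubalgebra π).val Subtype.val_injective,
    hσ.quotientHomeomorph hπ, hσ.isRegularIso_quotientHomeomorph hπ⟩

end IsTotalIntegral

end QuotientMap

end

end Observability

theorem theorem4p6 {k A B : Type u} [Field k] [IsAlgClosed k]
    [CommRing A] [HopfAlgebra k A] [Algebra.FiniteType k A] [IsReduced A]
    [CommRing B] [HopfAlgebra k B] [Algebra.FiniteType k B] [IsReduced B]
    (π : A →ₐc[k] B) (hπ : Function.Surjective π) :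
    List.TFAE [
      Observability.IsExactSubgroup π,
      Observability.IsAffineHomogeneousSpace π,
      ∃ σ : B →ₗ[k] A, Observability.IsTotalIntegral π σ] := by
  tfae_have 1 → 3 := fun h => h.exists_isTotalIntegral
  tfae_have 3 → 1 := fun ⟨_, hσ⟩ => hσ.hasLocalIntegrals.isExactSubgroup
  tfae_have 2 → 1 := fun h => (h.hasLocalIntegrals hπ).isExactSubgroup
  tfae_have 3 → 2 := fun ⟨_, hσ⟩ => hσ.isAffineHomogeneousSpace hπ
  tfae_finish
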